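/- Let $\Omega\subset\mathbb C$ be a bounded convex domain with smooth ($C^\infty$) boundary, and let $F=(f_{ij}):\Omega\to\mathbb C^{m\times p}$ be entrywise analytic on $\Omega$ and admit a continuous extension to $\overline\Omega$. Let $A\in\mathbb C^{n\times n}$ have numerical range $W(A):=\{v^*Av : v\in\mathbb C^n,\ \|v\|_2=1\}\subset\Omega$. Let $F(A)\in\mathbb C^{mn\times pn}$ denote the block matrix $$F(A)=\begin{bmatrix} f_{11}(A)&\cdots&f_{1p}(A)\\ \vdots&&\vdots\\ f_{m1}(A)&\cdots&f_{mp}(A)\end{bmatrix},$$ where, for a scalar function $f$ analytic on $\Omega$, $f(A)$ is the usual matrix function: $f(A)=q(A)$ for any polynomial $q$ such that $q^{(k)}(\lambda)=f^{(k)}(\lambda)$ for every eigenvalue $\lambda$ of $A$ and every $k\ge 0$ smaller than the multiplicity of $\lambda$ as a root of the minimal polynomial of $A$. Then $$\|F(A)\|_2\le (1+\sqrt2)\,\sup_{z\in\Omega}\|F(z)\|_2,$$ where $\|\cdot\|_2$ denotes the Euclidean norm of a vector and the spectral norm of a matrix. -/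

import Mathlib

open scoped Matrix.Norms.L2Operator ContDiff

namespace CrouzeixPalencia

/-- The numerical range `W(A) = {v* A v : v ∈ ℂⁿ, ‖v‖₂ = 1}`. -/
def numericalRange {n : ℕ} (A : Matrix (Fin n) (Fin n) ℂ) : Set ℂ :=
  {z | ∃ v : EuclideanSpace ℂ (Fin n), ‖v‖ = 1 ∧
    z = dotProduct (star v.ofLp) (A.mulVec v.ofLp)}

/-- A smooth, bounded, convex domain in the complex plane. Smoothness of the boundary is expressed
by local defining functions: near each boundary point the domain is the sublevel set `ρ < 0` of a
real-valued `C^∞` function `ρ` with non-vanishing differential there. -/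
structure IsSmoothBoundedConvexDomain (Ω : Set ℂ) : Prop where
  isOpen : IsOpen Ω
  nonempty : Ω.Nonempty
  convex : Convex ℝ Ω
  isBounded : Bornology.IsBounded Ω
  smooth_frontier : ∀ x ∈ frontier Ω, ∃ U : Set ℂ, IsOpen U ∧ x ∈ U ∧ ∃ ρ : ℂ → ℝ,
    ContDiffOn ℝ ∞ ρ U ∧ fderiv ℝ ρ x ≠ 0 ∧ ∀ z ∈ U, z ∈ Ω ↔ ρ z < 0

/-- `p` interpolates `f` on the spectrum of `A`, in the Hermite sense: at every eigenvalue `z` of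
`A`, the derivatives of `p` and `f` agree up to the order (exclusive) of `z` as a root of the minimal
polynomial of `A`. (If `z` is not an eigenvalue, the condition at `z` is void.) -/
def InterpolatesOnSpectrum {n : ℕ} (f : ℂ → ℂ) (A : Matrix (Fin n) (Fin n) ℂ)
    (p : Polynomial ℂ) : Prop :=
  ∀ z : ℂ, ∀ k < (minpoly ℂ A).rootMultiplicity z,
    (Polynomial.derivative^[k] p).eval z = iteratedDeriv k f z

theorem exists_interpolatesOnSpectrum {n : ℕ} (f : ℂ → ℂ) (A : Matrix (Fin n) (Fin n) ℂ) :
    ∃ p : Polynomial ℂ, InterpolatesOnSpectrum f A p := by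
  classical
  obtain ⟨y, hy⟩ := IsDedekindDomain.exists_forall_sub_mem_ideal
    (R := Polynomial ℂ) (s := (minpoly ℂ A).roots.toFinset)
    (fun z => Ideal.span {Polynomial.X - Polynomial.C z})
    (fun z => (minpoly ℂ A).rootMultiplicity z)
    (fun z _ => by
      refine (Ideal.prime_iff_isPrime ?_).2 ?_
      · simpa [Ideal.span_singleton_eq_bot] using Polynomial.X_sub_C_ne_zero z
      · exact (Ideal.span_singleton_prime (Polynomial.X_sub_C_ne_zero z)).2
          (Polynomial.prime_X_sub_C z))
    (fun z _ w _ hzw h => by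
      have h1 : Polynomial.X - Polynomial.C z ∈
          Ideal.span {Polynomial.X - Polynomial.C w} := by
        rw [← h]; exact Ideal.mem_span_singleton_self _
      rw [Ideal.mem_span_singleton, Polynomial.dvd_iff_isRoot] at h1
      simp [sub_eq_zero] at h1
      exact hzw h1.symm)
    (fun z => ∑ k ∈ Finset.range ((minpoly ℂ A).rootMultiplicity z.1),
      Polynomial.C (iteratedDeriv k f z.1 / (k.factorial : ℂ)) *
        (Polynomial.X - Polynomial.C z.1) ^ k)
  refine ⟨y, fun z k hk => ?_⟩
  have hz : z ∈ (minpoly ℂ A).roots.toFinset := by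
    rw [Multiset.mem_toFinset, ← Multiset.count_pos, Polynomial.count_roots]
    omega
  have h := hy z hz
  rw [Ideal.span_singleton_pow, Ideal.mem_span_singleton] at h
  obtain ⟨q, hq⟩ := h
  have h2 := congrArg (fun r => (Polynomial.taylor z r).coeff k) hq
  simp only [map_sub, Polynomial.taylor_mul, Polynomial.taylor_pow, map_sum,
    Polynomial.coeff_sub, Polynomial.finsetSum_coeff, Polynomial.taylor_X,
    Polynomial.taylor_C, add_sub_cancel_right, Polynomial.coeff_C_mul,
    Polynomial.coeff_X_pow, Polynomial.coeff_X_pow_mul', mul_ite, mul_one, mul_zero,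
    Finset.sum_ite_eq, Finset.mem_range, if_pos hk, if_neg (not_le.2 hk)] at h2
  rw [Polynomial.taylor_coeff, sub_eq_zero] at h2
  rw [← Polynomial.factorial_smul_hasseDeriv]
  have hk0 : (k.factorial : ℂ) ≠ 0 := by exact_mod_cast k.factorial_ne_zero
  rw [LinearMap.smul_apply, nsmul_eq_mul, Polynomial.eval_mul, h2, Polynomial.eval_natCast]
  field_simp

/-- The matrix function `f(A)`, defined for `f` analytic near the eigenvalues of `A` as `p(A)`, where
`p` is any polynomial that interpolates `f` on the spectrum of `A` in the Hermite sense. -/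
noncomputable def matrixFunction {n : ℕ} (f : ℂ → ℂ) (A : Matrix (Fin n) (Fin n) ℂ) :
    Matrix (Fin n) (Fin n) ℂ :=
  Polynomial.aeval A (exists_interpolatesOnSpectrum f A).choose

/-- The matrix function does not depend on the choice of the interpolating polynomial. -/
theorem matrixFunction_eq_aeval {n : ℕ} {f : ℂ → ℂ} {A : Matrix (Fin n) (Fin n) ℂ}
    {p : Polynomial ℂ} (hp : InterpolatesOnSpectrum f A p) :
    matrixFunction f A = Polynomial.aeval A p := by
  classical
  have hc := (exists_interpolatesOnSpectrum f A).choose_spec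
  unfold matrixFunction
  generalize (exists_interpolatesOnSpectrum f A).choose = q at hc
  rw [← sub_eq_zero, ← map_sub, ← minpoly.dvd_iff (A := ℂ)]
  have hm : minpoly ℂ A ≠ 0 := minpoly.ne_zero (Matrix.isIntegral A)
  by_cases hd : q - p = 0
  · rw [hd]; exact dvd_zero _
  refine (IsAlgClosed.splits _).dvd_of_roots_le_roots hm ?_
  rw [Multiset.le_iff_count]
  intro z
  rw [Polynomial.count_roots, Polynomial.count_roots]
  by_contra! hlt
  have := (Polynomial.lt_rootMultiplicity_iff_isRoot_iterate_derivative
    (t := z) (n := (q - p).rootMultiplicity z) hd).2 fun k hk => by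
      have hk' := lt_of_le_of_lt hk hlt
      rw [Polynomial.IsRoot, Polynomial.iterate_derivative_sub, Polynomial.eval_sub,
        hc z k hk', hp z k hk', sub_self]
  exact lt_irrefl _ this

/-- For a matrix-valued function `F`, the block matrix `F(A)` whose `(i, j)` block is the matrix
function `f_{ij}(A)` of the entry `f_{ij}` of `F`. -/
noncomputable def blockMatrixFunction {m p n : ℕ} (F : ℂ → Matrix (Fin m) (Fin p) ℂ)
    (A : Matrix (Fin n) (Fin n) ℂ) : Matrix (Fin m × Fin n) (Fin p × Fin n) ℂ :=
  Matrix.of fun x y => matrixFunction (fun z => F z x.1 y.1) A x.2 y.2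

/-- `‖F‖_Ω = sup_{z ∈ Ω} ‖F(z)‖₂`, where `‖·‖₂` is the spectral norm. -/
noncomputable def supNorm {m p : ℕ} (Ω : Set ℂ) (F : ℂ → Matrix (Fin m) (Fin p) ℂ) : ℝ :=
  ⨆ z : Ω, ‖F z‖

end CrouzeixPalencia

namespace CrouzeixPalencia

open scoped Matrix

/-! ### Calculus of matrix functions -/

/-! Scale so that `‖F‖ ≤ 1` on a convex open set `U`, surround `W(A)` by a convex curve in `U`, and
let `G` be the Cauchy transform of `Fᴴ` along the curve. Two estimates carry the proof.

(a) `‖G‖ ≤ 1` inside the curve (`norm_cauchyTransformStar_le`). Testing against vectors reduces this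
to scalar `f`. The conjugate of the Cauchy transform of `conj f` is the double layer potential of
`f` minus `f`. The double layer density is positive of mass 2. As `z` tends to a boundary point,
little more than half of the mass can stay away from that point, and the rest sees `f` almost
constant. This gives the bound near the boundary, and the maximum principle carries it inside.

(b) `‖F(A) + G(A)ᴴ‖ ≤ 2` (`norm_block_add_conjTranspose_le`). The sum is the integral of `F(σ) ⊗
Q(σ)`, where `Q = R + Rᴴ` for the normalised resolvent density `R`. Since `W(A)` lies on the inner
side of every tangent, `Q ≥ 0`, and `Q` integrates to `2·1`.

Put `X = F(A)`, `Y = G(A)`. Then `X Xᴴ X Xᴴ = X (X + Yᴴ)ᴴ X Xᴴ - (X Y X) Xᴴ`, and `X Y X = (F G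
F)(A)`, where `F G F` is again bounded by 1. With `L` the supremum of all such norms, `‖X‖⁴ ≤ 2‖X‖³
+ L‖X‖`. Letting `‖X‖` tend to `L` gives `L² ≤ 2L + 1`, so `L ≤ 1 + √2`.

The product `F G F` is controlled only inside the curve. The supremum therefore runs over all convex
open `U` containing a fixed compact convex `K`, as well as over `F`. It is finite because `K`
contains one fixed curve around `W(A)`, on which Cauchy's formula applies to every competitor. A
curve between `K` and each `U` comes from a log-sum-exp smoothing of the support function of a
finite net (`exists_isSupportCurve`). -/

theorem iteratedDeriv_polynomial_eval (p : Polynomial ℂ) (k : ℕ) :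
    iteratedDeriv k (fun z => p.eval z) = fun z => (Polynomial.derivative^[k] p).eval z := by
  induction k with
  | zero => simp
  | succ k ih =>
    rw [iteratedDeriv_succ, ih, Function.iterate_succ_apply']
    funext z
    exact Polynomial.deriv _

theorem analyticAt_polynomial_eval (p : Polynomial ℂ) (z : ℂ) :
    AnalyticAt ℂ (fun z => p.eval z) z :=
  p.differentiable.analyticAt z

/-- Hermite interpolation in terms of the order of vanishing of the error. -/
theorem interpolatesOnSpectrum_iff {n : ℕ} {f : ℂ → ℂ} {A : Matrix (Fin n) (Fin n) ℂ}
    {p : Polynomial ℂ} (hf : ∀ z, (minpoly ℂ A).IsRoot z → AnalyticAt ℂ f z) :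
    InterpolatesOnSpectrum f A p ↔ ∀ z, (minpoly ℂ A).IsRoot z →
      (((minpoly ℂ A).rootMultiplicity z : ℕ) : ℕ∞) ≤
        analyticOrderAt (f - fun w => p.eval w) z := by
  refine forall_congr' fun z => ?_
  by_cases hz : (minpoly ℂ A).IsRoot z
  · have hfz := hf z hz
    have hp := analyticAt_polynomial_eval p z
    simp only [hz, true_imp_iff]
    rw [natCast_le_analyticOrderAt_iff_iteratedDeriv_eq_zero (hfz.sub hp)]
    refine forall₂_congr fun k _ => ?_
    rw [iteratedDeriv_sub hfz.contDiffAt hp.contDiffAt, iteratedDeriv_polynomial_eval, sub_eq_zero,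
      eq_comm]
  · simp [Polynomial.rootMultiplicity_eq_zero hz]

theorem matrixFunction_eq_aeval_of_order {n : ℕ} {f : ℂ → ℂ} {A : Matrix (Fin n) (Fin n) ℂ}
    {p : Polynomial ℂ} (hf : ∀ z, (minpoly ℂ A).IsRoot z → AnalyticAt ℂ f z)
    (h : ∀ z, (minpoly ℂ A).IsRoot z → (((minpoly ℂ A).rootMultiplicity z : ℕ) : ℕ∞) ≤
        analyticOrderAt (f - fun w => p.eval w) z) :
    matrixFunction f A = Polynomial.aeval A p :=
  matrixFunction_eq_aeval ((interpolatesOnSpectrum_iff hf).2 h)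

theorem matrixFunction_polynomial {n : ℕ} (p : Polynomial ℂ) (A : Matrix (Fin n) (Fin n) ℂ) :
    matrixFunction (fun z => p.eval z) A = Polynomial.aeval A p :=
  matrixFunction_eq_aeval fun z k _ => by rw [iteratedDeriv_polynomial_eval]

theorem matrixFunction_add {n : ℕ} {f g : ℂ → ℂ} {A : Matrix (Fin n) (Fin n) ℂ}
    (hf : ∀ z, (minpoly ℂ A).IsRoot z → AnalyticAt ℂ f z)
    (hg : ∀ z, (minpoly ℂ A).IsRoot z → AnalyticAt ℂ g z) :
    matrixFunction (fun z => f z + g z) A = matrixFunction f A + matrixFunction g A := by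
  obtain ⟨p, hp⟩ := exists_interpolatesOnSpectrum f A
  obtain ⟨q, hq⟩ := exists_interpolatesOnSpectrum g A
  rw [matrixFunction_eq_aeval hp, matrixFunction_eq_aeval hq, ← map_add]
  refine matrixFunction_eq_aeval_of_order (fun z hz => (hf z hz).add (hg z hz)) fun z hz => ?_
  refine le_trans (le_min ((interpolatesOnSpectrum_iff hf).1 hp z hz)
    ((interpolatesOnSpectrum_iff hg).1 hq z hz)) (le_analyticOrderAt_add.trans (le_of_eq ?_))
  congr 1
  funext w
  simp only [Pi.add_apply, Pi.sub_apply, Polynomial.eval_add]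
  ring

theorem matrixFunction_mul {n : ℕ} {f g : ℂ → ℂ} {A : Matrix (Fin n) (Fin n) ℂ}
    (hf : ∀ z, (minpoly ℂ A).IsRoot z → AnalyticAt ℂ f z)
    (hg : ∀ z, (minpoly ℂ A).IsRoot z → AnalyticAt ℂ g z) :
    matrixFunction (fun z => f z * g z) A = matrixFunction f A * matrixFunction g A := by
  obtain ⟨p, hp⟩ := exists_interpolatesOnSpectrum f A
  obtain ⟨q, hq⟩ := exists_interpolatesOnSpectrum g A
  rw [matrixFunction_eq_aeval hp, matrixFunction_eq_aeval hq, ← map_mul]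
  refine matrixFunction_eq_aeval_of_order (fun z hz => (hf z hz).mul (hg z hz)) fun z hz => ?_
  have h1 := (interpolatesOnSpectrum_iff hf).1 hp z hz
  have h2 := (interpolatesOnSpectrum_iff hg).1 hq z hz
  have hp' := analyticAt_polynomial_eval p z
  have hq' := analyticAt_polynomial_eval q z
  -- The error splits as `f g - p q = f (g - q) + (f - p) q`, and each summand vanishes to the
  -- required order.
  have h3 : (((minpoly ℂ A).rootMultiplicity z : ℕ) : ℕ∞) ≤
      analyticOrderAt (f * (g - fun w => q.eval w)) z := by
    rw [analyticOrderAt_mul (hf z hz) ((hg z hz).sub hq')]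
    exact h2.trans le_add_self
  have h4 : (((minpoly ℂ A).rootMultiplicity z : ℕ) : ℕ∞) ≤
      analyticOrderAt ((f - fun w => p.eval w) * fun w => q.eval w) z := by
    rw [analyticOrderAt_mul ((hf z hz).sub hp') hq']
    exact h1.trans le_self_add
  refine (le_min h3 h4).trans (le_analyticOrderAt_add.trans (le_of_eq ?_))
  congr 1
  funext w
  simp only [Pi.add_apply, Pi.sub_apply, Pi.mul_apply, Polynomial.eval_mul]
  ring

theorem matrixFunction_const {n : ℕ} (c : ℂ) (A : Matrix (Fin n) (Fin n) ℂ) :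
    matrixFunction (fun _ => c) A = c • 1 := by
  simpa [Algebra.algebraMap_eq_smul_one] using matrixFunction_polynomial (Polynomial.C c) A

theorem matrixFunction_sum {n : ℕ} {ι : Type*} (s : Finset ι) {f : ι → ℂ → ℂ}
    {A : Matrix (Fin n) (Fin n) ℂ}
    (hf : ∀ i ∈ s, ∀ z, (minpoly ℂ A).IsRoot z → AnalyticAt ℂ (f i) z) :
    matrixFunction (fun z => ∑ i ∈ s, f i z) A = ∑ i ∈ s, matrixFunction (f i) A := by
  classical
  induction s using Finset.induction_on with
  | empty => simpa using matrixFunction_const 0 A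
  | insert a s ha ih =>
    simp only [Finset.sum_insert ha]
    rw [matrixFunction_add (hf a (Finset.mem_insert_self a s)), ih]
    · exact fun i hi => hf i (Finset.mem_insert_of_mem hi)
    · exact fun z hz => Finset.analyticAt_fun_sum _
        fun i hi => hf i (Finset.mem_insert_of_mem hi) z hz

/-- The sum of the squared absolute values of the entries of a vector. -/
noncomputable def sumSq {ι : Type*} [Fintype ι] (x : ι → ℂ) : ℝ := ∑ i, ‖x i‖ ^ 2

theorem sumSq_nonneg {ι : Type*} [Fintype ι] (x : ι → ℂ) : 0 ≤ sumSq x := by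
  unfold sumSq; positivity

theorem norm_toLp_sq {ι : Type*} [Fintype ι] (x : ι → ℂ) : ‖WithLp.toLp 2 x‖ ^ 2 = sumSq x := by
  rw [EuclideanSpace.norm_sq_eq, sumSq]

theorem star_dotProduct_self {ι : Type*} [Fintype ι] (x : ι → ℂ) :
    star x ⬝ᵥ x = (sumSq x : ℂ) := by
  simp only [dotProduct, sumSq, Pi.star_apply, RCLike.star_def, Complex.ofReal_sum]
  refine Finset.sum_congr rfl fun i _ => ?_
  rw [mul_comm, Complex.mul_conj, Complex.normSq_eq_norm_sq]

theorem sumSq_pos {ι : Type*} [Fintype ι] {x : ι → ℂ} (hx : x ≠ 0) : 0 < sumSq x := by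
  rw [← norm_toLp_sq]
  have : ‖WithLp.toLp 2 x‖ ≠ 0 := norm_ne_zero_iff.2 fun h => hx (by simpa using h)
  positivity

/-! ### The numerical range -/

theorem exists_mem_numericalRange {n : ℕ} (A : Matrix (Fin n) (Fin n) ℂ) {v : Fin n → ℂ}
    (hv : v ≠ 0) : ∃ z ∈ numericalRange A, star v ⬝ᵥ A.mulVec v = sumSq v * z := by
  set u : EuclideanSpace ℂ (Fin n) := WithLp.toLp 2 v with hu
  have hn : ‖u‖ ≠ 0 := norm_ne_zero_iff.2 fun h => hv (by simpa [hu] using h)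
  have hn' : (‖u‖ : ℂ) ≠ 0 := by exact_mod_cast hn
  have hsq : (sumSq v : ℂ) = (‖u‖ : ℂ) ^ 2 := by rw [← norm_toLp_sq]; push_cast; rfl
  have h2 : (((‖u‖⁻¹ : ℝ) : ℂ) • u).ofLp = ((‖u‖⁻¹ : ℝ) : ℂ) • v := rfl
  refine ⟨_, ⟨((‖u‖⁻¹ : ℝ) : ℂ) • u, ?_, rfl⟩, ?_⟩
  · rw [norm_smul]; simp [hn]
  · rw [h2, Matrix.mulVec_smul, star_smul, smul_dotProduct, dotProduct_smul, hsq]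
    simp only [smul_eq_mul, RCLike.star_def]
    rw [Complex.conj_ofReal, Complex.ofReal_inv]
    field_simp

/-- The roots of the minimal polynomial lie in the numerical range. -/
theorem mem_numericalRange_of_isRoot {n : ℕ} {A : Matrix (Fin n) (Fin n) ℂ} {z : ℂ}
    (hz : (minpoly ℂ A).IsRoot z) : z ∈ numericalRange A := by
  have hr : (minpoly ℂ (Matrix.toLin' A)).IsRoot z := by rwa [Matrix.minpoly_toLin']
  obtain ⟨v, hv⟩ := (Module.End.hasEigenvalue_of_isRoot hr).exists_hasEigenvector
  have hAv : A.mulVec v = z • v := by simpa using hv.apply_eq_smul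
  obtain ⟨w, hw, hvw⟩ := exists_mem_numericalRange A hv.2
  rw [hAv, dotProduct_smul, star_dotProduct_self, smul_eq_mul, mul_comm] at hvw
  have h0 : (sumSq v : ℂ) ≠ 0 := by exact_mod_cast (sumSq_pos hv.2).ne'
  rwa [mul_left_cancel₀ h0 hvw]

theorem isCompact_numericalRange {n : ℕ} (A : Matrix (Fin n) (Fin n) ℂ) :
    IsCompact (numericalRange A) := by
  have h1 : numericalRange A = (fun v : EuclideanSpace ℂ (Fin n) =>
      star v.ofLp ⬝ᵥ A.mulVec v.ofLp) '' Metric.sphere 0 1 := by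
    ext z
    simp only [numericalRange, Set.mem_ofPred_eq, Set.mem_image, mem_sphere_zero_iff_norm]
    exact exists_congr fun v => and_congr_right fun _ => eq_comm
  rw [h1]
  refine (isCompact_sphere _ _).image ?_
  have : Continuous fun v : EuclideanSpace ℂ (Fin n) => v.ofLp := PiLp.continuous_ofLp 2 _
  exact this.star.dotProduct (continuous_const.matrix_mulVec this)

/-! ### Cauchy transforms and matrix functions -/

theorem norm_sub_ge_of_ball_subset {V : Set ℂ} {z₀ z u : ℂ} {r : ℝ}
    (hV : Metric.ball z₀ (r + r) ⊆ V) (hz : z ∈ Metric.ball z₀ r) (hu : u ∉ V) : r ≤ ‖u - z‖ := by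
  by_contra! h
  refine hu (hV ?_)
  rw [Metric.mem_ball] at hz ⊢
  rw [← dist_eq_norm] at h
  exact (dist_triangle u z z₀).trans_lt (add_lt_add h hz)

/-- The Cauchy transform along a continuous curve is holomorphic off the curve. -/
theorem differentiableOn_cauchyTransform {γ w : ℝ → ℂ} {V : Set ℂ} {a b : ℝ} (hV : IsOpen V)
    (hγ : Continuous γ) (hw : Continuous w) (hγV : ∀ t ∈ Set.uIcc a b, γ t ∉ V) :
    DifferentiableOn ℂ (fun z => ∫ t in a..b, w t / (γ t - z)) V := by
  have hne : ∀ z ∈ V, ∀ t ∈ Set.uIcc a b, γ t - z ≠ 0 := fun z hz t ht h =>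
    hγV t ht (by rwa [sub_eq_zero.1 h])
  have hc : ∀ z ∈ V, ContinuousOn (fun t => w t / (γ t - z)) (Set.uIcc a b) := fun z hz =>
    hw.continuousOn.div (hγ.sub continuous_const).continuousOn (hne z hz)
  intro z₀ hz₀
  obtain ⟨R, hR, hRV⟩ := Metric.isOpen_iff.1 hV z₀ hz₀
  -- Halving the radius keeps the curve at distance at least `r` from every `z` in the smaller ball,
  -- so `‖w‖ / r²` dominates the derivative of the integrand.
  set r := R / 2 with hr
  have hr0 : 0 < r := by positivity
  have hrV : Metric.ball z₀ (r + r) ⊆ V := by rwa [hr, add_halves]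
  have hsub : Metric.ball z₀ r ⊆ V :=
    (Metric.ball_subset_ball (by linarith)).trans hrV
  refine (intervalIntegral.hasDerivAt_integral_of_dominated_loc_of_deriv_le
    (F' := fun z t => w t / (γ t - z) ^ 2) (bound := fun t => ‖w t‖ / r ^ 2)
    (Metric.ball_mem_nhds z₀ hr0) ?_ (hc z₀ hz₀).intervalIntegrable ?_ ?_ ?_
    ?_).2.differentiableAt.differentiableWithinAt
  · filter_upwards [hV.mem_nhds hz₀] with z hz
    exact ((hc z hz).mono Set.uIoc_subset_uIcc).aestronglyMeasurable measurableSet_uIoc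
  · exact ((hw.continuousOn.div ((hγ.sub continuous_const).pow 2).continuousOn
      fun t ht => pow_ne_zero 2 (hne z₀ hz₀ t ht)).mono Set.uIoc_subset_uIcc).aestronglyMeasurable
      measurableSet_uIoc
  · refine Filter.Eventually.of_forall fun t ht z hz => ?_
    have := norm_sub_ge_of_ball_subset hrV hz (hγV t (Set.uIoc_subset_uIcc ht))
    rw [norm_div, norm_pow]
    gcongr
  · exact (by fun_prop : Continuous fun t => ‖w t‖ / r ^ 2).intervalIntegrable _ _
  · refine Filter.Eventually.of_forall fun t ht z hz => ?_
    have h1 : HasDerivAt (fun z => γ t - z) (-1) z := by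
      simpa using (hasDerivAt_id z).const_sub (γ t)
    have := (hasDerivAt_const z (w t)).div h1 (hne z (hsub hz) t (Set.uIoc_subset_uIcc ht))
    convert! this using 1
    simp

/-- The polynomial `(m(s) - m(X)) / (s - X)`. -/
noncomputable def divDiff (m : Polynomial ℂ) (s : ℂ) : Polynomial ℂ :=
  ∑ j ∈ Finset.range (m.natDegree + 1), ∑ i ∈ Finset.range j,
    (m.coeff j * s ^ i) • Polynomial.X ^ (j - 1 - i)

/-- Each `s ^ j - X ^ j` is `s - X` times a geometric sum. When `m(A) = 0` and `m(s) ≠ 0`, the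
identity exhibits `divDiff m s` at `A`, divided by `m(s)`, as the resolvent `(s - A)⁻¹`. -/
theorem divDiff_mul (m : Polynomial ℂ) (s : ℂ) :
    divDiff m s * (Polynomial.C s - Polynomial.X) = Polynomial.C (m.eval s) - m := by
  have h1 : Polynomial.C (m.eval s) - m = ∑ j ∈ Finset.range (m.natDegree + 1),
      m.coeff j • (Polynomial.C s ^ j - Polynomial.X ^ j) := by
    simp only [smul_sub, Finset.sum_sub_distrib]
    congr 1
    · rw [Polynomial.eval_eq_sum_range, map_sum]
      refine Finset.sum_congr rfl fun j _ => ?_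
      simp [Polynomial.smul_eq_C_mul]
    · conv_lhs => rw [m.as_sum_range_C_mul_X_pow]
      simp only [Polynomial.smul_eq_C_mul]
  rw [h1, divDiff, Finset.sum_mul]
  refine Finset.sum_congr rfl fun j _ => ?_
  rw [← (Commute.all (Polynomial.C s) Polynomial.X).geom_sum₂_mul, ← smul_mul_assoc,
    Finset.smul_sum]
  congr 1
  refine Finset.sum_congr rfl fun i _ => ?_
  simp only [Polynomial.smul_eq_C_mul, map_mul, map_pow, mul_assoc]

theorem rootMultiplicity_le_analyticOrderAt (m : Polynomial ℂ) (z : ℂ) :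
    ((m.rootMultiplicity z : ℕ) : ℕ∞) ≤ analyticOrderAt (fun w => m.eval w) z := by
  obtain ⟨q, hq⟩ := Polynomial.pow_rootMultiplicity_dvd m z
  rw [natCast_le_analyticOrderAt (analyticAt_polynomial_eval m z)]
  refine ⟨fun w => q.eval w, analyticAt_polynomial_eval q z, Filter.Eventually.of_forall fun w => ?_⟩
  conv_lhs => rw [hq]
  simp

/-- The matrix function of a Cauchy transform is the corresponding integral of resolvents. -/
theorem matrixFunction_eq_integral {n : ℕ} {f : ℂ → ℂ} {A : Matrix (Fin n) (Fin n) ℂ}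
    {γ w : ℝ → ℂ} {V : Set ℂ} {a b : ℝ} (hV : IsOpen V) (hγ : Continuous γ) (hw : Continuous w)
    (hγV : ∀ t, γ t ∉ V) (hA : ∀ z, (minpoly ℂ A).IsRoot z → z ∈ V)
    (hf : ∀ z ∈ V, f z = ∫ t in a..b, w t / (γ t - z)) (k l : Fin n) :
    matrixFunction f A k l = ∫ t in a..b, w t * (γ t • (1 : Matrix (Fin n) (Fin n) ℂ) - A)⁻¹ k l := by
  set m := minpoly ℂ A with hm
  have hmγ : ∀ t, m.eval (γ t) ≠ 0 := fun t h => hγV t (hA _ h)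
  have hcm : Continuous fun t => m.eval (γ t) := m.continuous.comp hγ
  set u : ℝ → ℂ := fun t => w t / m.eval (γ t) with hu
  have huc : Continuous u := hw.div hcm hmγ
  have hfan : ∀ z ∈ V, AnalyticAt ℂ f z := fun z hz =>
    ((differentiableOn_cauchyTransform hV hγ hw fun t _ => hγV t).congr hf).analyticAt (hV.mem_nhds hz)
  -- The interpolant is the integral of `w / m(γ)` times `divDiff m γ`, taken coefficient by
  -- coefficient so that it is a polynomial.
  set p : Polynomial ℂ := ∑ j ∈ Finset.range (m.natDegree + 1), ∑ i ∈ Finset.range j,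
    (∫ t in a..b, u t * (m.coeff j * γ t ^ i)) • Polynomial.X ^ (j - 1 - i) with hp
  have hint : ∀ j i : ℕ, ∀ c : ℂ, IntervalIntegrable (fun t => u t * (m.coeff j * γ t ^ i * c))
      MeasureTheory.volume a b := fun j i c =>
    (by fun_prop : Continuous fun t => u t * (m.coeff j * γ t ^ i * c)).intervalIntegrable _ _
  have key : ∀ φ : ℕ → ℂ, ∑ j ∈ Finset.range (m.natDegree + 1), ∑ i ∈ Finset.range j,
      (∫ t in a..b, u t * (m.coeff j * γ t ^ i)) * φ (j - 1 - i) =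
      ∫ t in a..b, u t * ∑ j ∈ Finset.range (m.natDegree + 1), ∑ i ∈ Finset.range j,
        (m.coeff j * γ t ^ i) * φ (j - 1 - i) := by
    intro φ
    simp only [Finset.mul_sum]
    rw [intervalIntegral.integral_finsetSum fun j _ =>
      (continuous_finsetSum _ fun i _ => by fun_prop).intervalIntegrable _ _]
    refine Finset.sum_congr rfl fun j _ => ?_
    rw [intervalIntegral.integral_finsetSum fun i _ => hint j i _]
    refine Finset.sum_congr rfl fun i _ => ?_
    rw [← intervalIntegral.integral_mul_const]
    simp only [mul_assoc]
  have hpz : ∀ z, p.eval z = ∫ t in a..b, u t * (divDiff m (γ t)).eval z := by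
    intro z
    simpa [hp, divDiff, Polynomial.eval_finsetSum] using key fun j => z ^ j
  have hpA : Polynomial.aeval A p k l =
      ∫ t in a..b, u t * Polynomial.aeval A (divDiff m (γ t)) k l := by
    simpa [hp, divDiff, Matrix.sum_apply] using key fun j => (A ^ j) k l
  have hfp : matrixFunction f A = Polynomial.aeval A p := by
    refine matrixFunction_eq_aeval_of_order (fun z hz => hfan z (hA z hz)) fun z hz => ?_
    have hzV := hA z hz
    have hh := (differentiableOn_cauchyTransform (a := a) (b := b) hV hγ huc fun t _ => hγV t).analyticAt (hV.mem_nhds hzV)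
    -- From `1/(s - x) - divDiff m s (x) / m(s) = m(x) / (m(s) (s - x))`, the error is `m` times a
    -- holomorphic Cauchy transform. It vanishes at least to the order of the roots of `m`.
    have heq : (f - fun w => p.eval w) =ᶠ[nhds z]
        (fun w => m.eval w) * fun z => ∫ t in a..b, u t / (γ t - z) := by
      filter_upwards [hV.mem_nhds hzV] with x hx
      have hne : ∀ t, γ t - x ≠ 0 := fun t h => hγV t (by rwa [sub_eq_zero.1 h])
      simp only [Pi.sub_apply, Pi.mul_apply]
      have hdc : Continuous fun t => (divDiff m (γ t)).eval x := by
        simp only [divDiff, Polynomial.eval_finsetSum]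
        refine continuous_finsetSum _ fun j _ => continuous_finsetSum _ fun i _ => ?_
        simp only [Polynomial.eval_smul]
        fun_prop
      rw [hf x hx, hpz, ← intervalIntegral.integral_sub, ← intervalIntegral.integral_const_mul]
      · refine intervalIntegral.integral_congr fun t _ => ?_
        have h1 := congrArg (Polynomial.eval x) (divDiff_mul m (γ t))
        simp only [Polynomial.eval_mul, Polynomial.eval_sub, Polynomial.eval_C,
          Polynomial.eval_X] at h1
        have h2 := hne t
        have h3 := hmγ t
        simp only [hu]
        field_simp
        linear_combination (-w t) * h1
      · exact (hw.div (hγ.sub continuous_const) hne).intervalIntegrable _ _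
      · exact (huc.mul hdc).intervalIntegrable _ _
    rw [analyticOrderAt_congr heq, analyticOrderAt_mul (analyticAt_polynomial_eval m z) hh]
    exact (rootMultiplicity_le_analyticOrderAt m z).trans le_self_add
  rw [hfp, hpA]
  refine intervalIntegral.integral_congr fun t _ => ?_
  have h1 := congrArg (Polynomial.aeval A) (divDiff_mul m (γ t))
  simp only [map_mul, map_sub, Polynomial.aeval_C, Polynomial.aeval_X, hm, minpoly.aeval,
    sub_zero, Algebra.algebraMap_eq_smul_one] at h1
  rw [← hm] at h1
  have h2 : (γ t • (1 : Matrix (Fin n) (Fin n) ℂ) - A)⁻¹ =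
      (m.eval (γ t))⁻¹ • Polynomial.aeval A (divDiff m (γ t)) := by
    refine Matrix.inv_eq_left_inv ?_
    rw [smul_mul_assoc, h1, smul_smul, inv_mul_cancel₀ (hmγ t), one_smul]
  simp only [h2, Matrix.smul_apply, smul_eq_mul, hu]
  ring

end CrouzeixPalencia

namespace CrouzeixPalencia

open Complex Set Filter Topology

/-! ### Convex curves parametrised by the angle of the outward normal -/

/-- The unit vector of angle `t`. -/
noncomputable def unitNormal (t : ℝ) : ℂ := exp (t * I)

local notation "conj" => starRingEnd ℂ

@[fun_prop]
theorem continuous_unitNormal : Continuous unitNormal := by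
  unfold unitNormal; fun_prop

theorem norm_unitNormal (t : ℝ) : ‖unitNormal t‖ = 1 := norm_exp_ofReal_mul_I t

theorem unitNormal_mul_conj (t : ℝ) : unitNormal t * conj (unitNormal t) = 1 := by
  rw [mul_conj, normSq_eq_norm_sq, norm_unitNormal]; simp

theorem conj_unitNormal_ne_zero (t : ℝ) : conj (unitNormal t) ≠ 0 :=
  right_ne_zero_of_mul_eq_one (unitNormal_mul_conj t)

theorem unitNormal_mul_conj_eq (t s : ℝ) :
    unitNormal t * conj (unitNormal s) = unitNormal (t - s) := by
  simp only [unitNormal, ← exp_conj, ← exp_add, map_mul, conj_I, conj_ofReal]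
  congr 1
  push_cast
  ring

theorem unitNormal_im (t : ℝ) : (unitNormal t).im = Real.sin t := exp_ofReal_mul_I_im t

theorem unitNormal_periodic : Function.Periodic unitNormal (2 * Real.pi) := fun t => by
  simp only [unitNormal]
  push_cast
  rw [add_mul, exp_add, exp_two_pi_mul_I, mul_one]

theorem hasDerivAt_unitNormal (t : ℝ) : HasDerivAt unitNormal (I * unitNormal t) t := by
  have h : HasDerivAt (fun t : ℝ => (t : ℂ) * I) I t := by
    simpa using (hasDerivAt_id t).ofReal_comp.mul_const I
  have := h.cexp
  rwa [mul_comm] at this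

theorem hasDerivAt_conj_unitNormal (t : ℝ) :
    HasDerivAt (fun t => conj (unitNormal t)) (-I * conj (unitNormal t)) t := by
  simpa using (hasDerivAt_unitNormal t).star

/-- A closed convex curve with continuous positive radius of curvature `ρ`, parametrised by the
angle of its outward normal. -/
structure IsSupportCurve (γ : ℝ → ℂ) (ρ : ℝ → ℝ) : Prop where
  continuous_radius : Continuous ρ
  radius_pos : ∀ t, 0 < ρ t
  hasDerivAt : ∀ t, HasDerivAt γ (I * (ρ t * unitNormal t)) t
  periodic : Function.Periodic γ (2 * Real.pi)
  radius_periodic : Function.Periodic ρ (2 * Real.pi)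

/-- The open region enclosed by a convex curve parametrised by its normal angle. -/
def enclosed (γ : ℝ → ℂ) : Set ℂ := {z | ∀ t, 0 < ((γ t - z) * conj (unitNormal t)).re}

/-- The normalised complex length element `dσ / (2πi dt)` of the curve. -/
noncomputable def lengthElement (ρ : ℝ → ℝ) (t : ℝ) : ℂ := ρ t * unitNormal t / (2 * Real.pi)

/-- The density of the double layer potential `d arg(σ - z) / π`. -/
noncomputable def doubleLayer (γ : ℝ → ℂ) (ρ : ℝ → ℝ) (z : ℂ) (t : ℝ) : ℝ :=
  (2 * (lengthElement ρ t / (γ t - z))).re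

theorem notMem_enclosed (γ : ℝ → ℂ) (t : ℝ) : γ t ∉ enclosed γ := fun h => by
  simpa using h t

theorem sub_ne_zero_of_mem_enclosed {γ : ℝ → ℂ} {z : ℂ} (hz : z ∈ enclosed γ) (t : ℝ) :
    γ t - z ≠ 0 := fun h => notMem_enclosed γ t (by rwa [sub_eq_zero.1 h])

/-- An intersection of half-planes. Convexity makes the region an admissible domain for `F G F` in
the extremal argument. -/
theorem convex_enclosed (γ : ℝ → ℂ) : Convex ℝ (enclosed γ) := by
  intro x hx y hy a b ha hb hab t
  have h1 := hx t
  have h2 := hy t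
  have : ((γ t - (a • x + b • y)) * conj (unitNormal t)).re =
      a * ((γ t - x) * conj (unitNormal t)).re + b * ((γ t - y) * conj (unitNormal t)).re := by
    have hb' : b = 1 - a := by linarith
    subst hb'
    simp only [mul_re, sub_re, sub_im, add_re, add_im, real_smul, ofReal_re, ofReal_im, mul_im]
    ring
  rw [this]
  rcases ha.eq_or_lt with rfl | ha'
  · simp only [zero_add] at hab
    subst hab
    simpa using h2
  · exact add_pos_of_pos_of_nonneg (mul_pos ha' h1) (mul_nonneg hb h2.le)

namespace IsSupportCurve

variable {γ : ℝ → ℂ} {ρ : ℝ → ℝ}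

theorem continuous (h : IsSupportCurve γ ρ) : Continuous γ :=
  continuous_iff_continuousAt.2 fun t => (h.hasDerivAt t).continuousAt

theorem continuous_lengthElement (h : IsSupportCurve γ ρ) : Continuous (lengthElement ρ) := by
  have := h.continuous_radius
  unfold lengthElement
  fun_prop

theorem exists_norm_le (h : IsSupportCurve γ ρ) : ∃ C, ∀ t, ‖γ t‖ ≤ C := by
  obtain ⟨C, hC⟩ := (isCompact_Icc (a := (0 : ℝ)) (b := 0 + 2 * Real.pi)).exists_bound_of_continuousOn
    h.continuous.continuousOn
  refine ⟨C, fun t => ?_⟩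
  obtain ⟨s, hs, hst⟩ := h.periodic.exists_mem_Ico₀ Real.two_pi_pos t
  rw [hst]
  exact hC s ⟨hs.1, by linarith [hs.2]⟩

theorem isBounded_enclosed (h : IsSupportCurve γ ρ) : Bornology.IsBounded (enclosed γ) := by
  obtain ⟨C, hC⟩ := h.exists_norm_le
  refine (Metric.isBounded_iff_subset_closedBall 0).2 ⟨C, fun z hz => ?_⟩
  -- In the direction of `z` itself the defining inequality bounds `‖z‖` by the normal coordinate of
  -- a point of the curve.
  have h1 := hz (arg z)
  have h2 : z * conj (unitNormal (arg z)) = ‖z‖ := by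
    conv_lhs => rw [← norm_mul_exp_arg_mul_I z]
    rw [mul_assoc]
    change _ * (unitNormal (arg _) * _) = _
    rw [norm_mul_exp_arg_mul_I, unitNormal_mul_conj, mul_one]
  rw [sub_mul, h2, sub_re, ofReal_re] at h1
  have h3 := (re_le_norm (γ (arg z) * conj (unitNormal (arg z))))
  rw [norm_mul, norm_conj, norm_unitNormal, mul_one] at h3
  rw [mem_closedBall_zero_iff]
  linarith [hC (arg z)]

theorem mem_enclosed_iff (h : IsSupportCurve γ ρ) {z : ℂ} :
    z ∈ enclosed γ ↔ ∀ t ∈ Icc 0 (2 * Real.pi), 0 < ((γ t - z) * conj (unitNormal t)).re := by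
  refine ⟨fun hz t _ => hz t, fun hz t => ?_⟩
  have hper : Function.Periodic (fun t => ((γ t - z) * conj (unitNormal t)).re) (2 * Real.pi) :=
    fun t => by simp only [h.periodic t, unitNormal_periodic t]
  obtain ⟨s, hs, hst⟩ := hper.exists_mem_Ico₀ Real.two_pi_pos t
  rw [hst]
  exact hz s ⟨hs.1, hs.2.le⟩

theorem isOpen_enclosed (h : IsSupportCurve γ ρ) : IsOpen (enclosed γ) := by
  have hγ := h.continuous
  rw [isOpen_iff_mem_nhds]
  intro z hz
  have : ∀ᶠ w in 𝓝 z, ∀ t ∈ Icc 0 (2 * Real.pi), 0 < ((γ t - w) * conj (unitNormal t)).re := by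
    refine isCompact_Icc.eventually_forall_of_forall_eventually fun t _ => ?_
    have hc : Continuous fun p : ℂ × ℝ => ((γ p.2 - p.1) * conj (unitNormal p.2)).re := by
      have : Continuous (conj) := continuous_conj
      fun_prop
    exact hc.continuousAt.eventually (lt_mem_nhds (hz t))
  filter_upwards [this] with w hw using h.mem_enclosed_iff.2 hw

/-- In the frame rotating with the normal, the real part is the signed distance from `z` to the
tangent and its derivative is the imaginary part. -/
theorem hasDerivAt_support (h : IsSupportCurve γ ρ) (z : ℂ) (t : ℝ) :
    HasDerivAt (fun t => (γ t - z) * conj (unitNormal t))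
      (I * ρ t - I * ((γ t - z) * conj (unitNormal t))) t := by
  have := ((h.hasDerivAt t).sub_const z).mul (hasDerivAt_conj_unitNormal t)
  convert! this using 1
  linear_combination (-I * ρ t) * unitNormal_mul_conj t

/-- At a frontier point the distance to the tangents is nonnegative and vanishes at some angle. This
is a minimum, so the tangential coordinate, its derivative, vanishes too and `z` is the point of
tangency. -/
theorem frontier_enclosed_subset (h : IsSupportCurve γ ρ) : frontier (enclosed γ) ⊆ range γ := by
  intro z hz
  rw [h.isOpen_enclosed.frontier_eq] at hz
  have hnn : ∀ t, 0 ≤ ((γ t - z) * conj (unitNormal t)).re := by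
    intro t
    have hcl : IsClosed {w : ℂ | 0 ≤ ((γ t - w) * conj (unitNormal t)).re} :=
      isClosed_le continuous_const (by fun_prop)
    exact closure_minimal (fun w hw => (hw t).le) hcl hz.1
  obtain ⟨t, ht⟩ : ∃ t, ((γ t - z) * conj (unitNormal t)).re ≤ 0 := by
    by_contra! hcon
    exact hz.2 hcon
  have ht0 := le_antisymm ht (hnn t)
  have hmin : IsLocalMin (fun s => ((γ s - z) * conj (unitNormal s)).re) t :=
    Filter.Eventually.of_forall fun s => by
      exact ht0.le.trans (hnn s)
  have hd := hmin.hasDerivAt_eq_zero (reCLM.hasFDerivAt.comp_hasDerivAt t (h.hasDerivAt_support z t))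
  have him : ((γ t - z) * conj (unitNormal t)).im = 0 := by
    simpa using hd
  have h0 : (γ t - z) * conj (unitNormal t) = 0 := Complex.ext ht0 him
  exact ⟨t, sub_eq_zero.1 ((mul_eq_zero.1 h0).resolve_right (conj_unitNormal_ne_zero t))⟩

/-- Strict convexity: the curve lies strictly on one side of each of its tangents. -/
theorem re_chord_neg (h : IsSupportCurve γ ρ) {s t : ℝ} (ht : t ∈ Ioo s (s + 2 * Real.pi)) :
    ((γ t - γ s) * conj (unitNormal s)).re < 0 := by
  set ψ : ℝ → ℝ := fun t => ((γ t - γ s) * conj (unitNormal s)).re with hψ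
  have hd : ∀ t, HasDerivAt ψ (-(ρ t * Real.sin (t - s))) t := by
    intro t
    have := reCLM.hasFDerivAt.comp_hasDerivAt t
      (((h.hasDerivAt t).sub_const (γ s)).mul_const (conj (unitNormal s)))
    convert! this using 1
    have h1 : I * (ρ t * unitNormal t) * conj (unitNormal s) =
        I * (ρ t * (unitNormal t * conj (unitNormal s))) := by ring
    rw [reCLM_apply, h1, unitNormal_mul_conj_eq, I_mul_re, im_ofReal_mul, unitNormal_im]
  have hc : Continuous ψ := continuous_iff_continuousAt.2 fun t => (hd t).continuousAt
  have hs0 : ψ s = 0 := by simp [hψ]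
  -- Since `ψ' = -ρ sin(t - s)`, `ψ` falls on the first half turn and rises on the second, and it is
  -- zero at both ends.
  rcases le_or_gt t (s + Real.pi) with hle | hgt
  · have hanti : StrictAntiOn ψ (Icc s (s + Real.pi)) := by
      refine strictAntiOn_of_deriv_neg (convex_Icc _ _) hc.continuousOn fun x hx => ?_
      rw [interior_Icc] at hx
      rw [(hd x).deriv]
      have := Real.sin_pos_of_pos_of_lt_pi (x := x - s) (by linarith [hx.1]) (by linarith [hx.2])
      have := mul_pos (h.radius_pos x) this
      linarith
    have := hanti (left_mem_Icc.2 (by linarith [Real.pi_pos])) ⟨ht.1.le, hle⟩ ht.1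
    rwa [hs0] at this
  · have hmono : StrictMonoOn ψ (Icc (s + Real.pi) (s + 2 * Real.pi)) := by
      refine strictMonoOn_of_deriv_pos (convex_Icc _ _) hc.continuousOn fun x hx => ?_
      rw [interior_Icc] at hx
      rw [(hd x).deriv]
      have := Real.sin_pos_of_pos_of_lt_pi (x := x - s - Real.pi) (by linarith [hx.1])
        (by linarith [hx.2])
      rw [Real.sin_sub_pi] at this
      have := mul_pos (h.radius_pos x) this
      linarith
    have := hmono ⟨hgt.le, ht.2.le⟩ (right_mem_Icc.2 (by linarith [Real.pi_pos])) ht.2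
    have h2 : ψ (s + 2 * Real.pi) = 0 := by simp [hψ, h.periodic s]
    rwa [h2] at this

theorem doubleLayer_eq (γ : ℝ → ℂ) (ρ : ℝ → ℝ) (z : ℂ) (t : ℝ) :
    doubleLayer γ ρ z t = (I * (ρ t * unitNormal t) / (γ t - z)).im / Real.pi := by
  have h1 : 2 * (lengthElement ρ t / (γ t - z)) =
      (ρ t * unitNormal t / (γ t - z)) / (Real.pi : ℝ) := by
    unfold lengthElement
    have : (Real.pi : ℂ) ≠ 0 := by exact_mod_cast Real.pi_ne_zero
    by_cases hz : γ t - z = 0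
    · simp [hz]
    · field_simp
  rw [doubleLayer, h1, div_ofReal_re, mul_div_assoc I, I_mul_im]

/-- The density is `ρ / π` times the distance from `z` to the tangent, divided by `|γ - z|²`. -/
theorem doubleLayer_pos (h : IsSupportCurve γ ρ) {z : ℂ} (hz : z ∈ enclosed γ) (t : ℝ) :
    0 < doubleLayer γ ρ z t := by
  have hne := sub_ne_zero_of_mem_enclosed hz t
  have h1 : unitNormal t / (γ t - z) = conj ((γ t - z) * conj (unitNormal t)) /
      ((normSq (γ t - z) : ℝ) : ℂ) := by
    rw [normSq_eq_conj_mul_self, map_mul, conj_conj]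
    have : conj (γ t - z) ≠ 0 := (map_ne_zero _).2 hne
    field_simp
  rw [doubleLayer_eq, mul_div_assoc, I_mul_im, mul_div_assoc, re_ofReal_mul, h1, div_ofReal_re,
    conj_re]
  exact div_pos (mul_pos (h.radius_pos t) (div_pos (hz t) (normSq_pos.2 hne))) Real.pi_pos

/-- Multiplied by the conjugate normal, `γ - z` stays in the right half-plane, where `log` is smooth
and here periodic. The factor `conj (unitNormal t)` lowers the logarithmic derivative by exactly
`I`, which accounts for the full turn. -/
theorem integral_logDeriv (h : IsSupportCurve γ ρ) {z : ℂ} (hz : z ∈ enclosed γ) :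
    ∫ t in (0 : ℝ)..2 * Real.pi, lengthElement ρ t / (γ t - z) = 1 := by
  have hne := sub_ne_zero_of_mem_enclosed hz
  have hc : Continuous fun t => I * (ρ t * unitNormal t) / (γ t - z) := by
    have := h.continuous
    have := h.continuous_radius
    exact Continuous.div (by fun_prop) (by fun_prop) hne
  have hd : ∀ t, HasDerivAt (fun t => log ((γ t - z) * conj (unitNormal t)))
      (I * (ρ t * unitNormal t) / (γ t - z) - I) t := by
    intro t
    have := (h.hasDerivAt_support z t).clog_real (Or.inl (hz t))
    convert! this using 1
    have h1 := hne t
    have h2 := conj_unitNormal_ne_zero t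
    field_simp
    linear_combination ρ t * unitNormal_mul_conj t
  have hint := intervalIntegral.integral_eq_sub_of_hasDerivAt (a := 0) (b := 2 * Real.pi)
    (fun t _ => hd t) ((hc.sub continuous_const).intervalIntegrable _ _)
  have hp := h.periodic 0
  have hp' := unitNormal_periodic 0
  rw [zero_add] at hp hp'
  rw [hp, hp', sub_self, intervalIntegral.integral_sub (hc.intervalIntegrable _ _)
    (continuous_const.intervalIntegrable _ _), intervalIntegral.integral_const, sub_zero,
    sub_eq_zero] at hint
  have hpi : (Real.pi : ℂ) ≠ 0 := by exact_mod_cast Real.pi_ne_zero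
  have h1 : ∀ t, lengthElement ρ t / (γ t - z) =
      (2 * Real.pi * I)⁻¹ * (I * (ρ t * unitNormal t) / (γ t - z)) := by
    intro t
    have := hne t
    have := I_ne_zero
    unfold lengthElement
    field_simp
  simp only [h1]
  rw [intervalIntegral.integral_const_mul, hint, real_smul]
  push_cast
  exact inv_mul_cancel₀ (by simp [hpi])

/-- Cauchy's integral formula for a curve inside a convex domain of holomorphy. -/
theorem cauchy_formula (h : IsSupportCurve γ ρ) {U : Set ℂ} (hU : IsOpen U) (hUc : Convex ℝ U)
    (hγU : ∀ t, γ t ∈ U) {f : ℂ → ℂ} (hf : DifferentiableOn ℂ f U) {z : ℂ} (hz : z ∈ enclosed γ)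
    (hzU : z ∈ U) :
    f z = ∫ t in (0 : ℝ)..2 * Real.pi, f (γ t) * lengthElement ρ t / (γ t - z) := by
  have hne := sub_ne_zero_of_mem_enclosed hz
  have hγ := h.continuous
  have hk := h.continuous_lengthElement
  have hds : DifferentiableOn ℂ (dslope f z) U :=
    (Complex.differentiableOn_dslope (hU.mem_nhds hzU)).2 hf
  -- On the convex set `U` the divided difference has a primitive, so its integral along the closed
  -- curve is zero; only `f z` times the integral of the Cauchy kernel remains.
  obtain ⟨g, hg⟩ := hUc.exists_forall_hasDerivWithinAt hds
  have hg' : ∀ w ∈ U, HasDerivAt g (dslope f z w) w := fun w hw =>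
    (hg w hw).hasDerivAt (hU.mem_nhds hw)
  have hfc : Continuous fun t => f (γ t) := hf.continuousOn.comp_continuous hγ hγU
  have hdc : Continuous fun t => dslope f z (γ t) := hds.continuousOn.comp_continuous hγ hγU
  have hd : ∀ t, HasDerivAt (fun t => g (γ t)) (dslope f z (γ t) * (I * (ρ t * unitNormal t))) t :=
    fun t => (hg' _ (hγU t)).comp t (h.hasDerivAt t)
  have hρ := h.continuous_radius
  have hint := intervalIntegral.integral_eq_sub_of_hasDerivAt (a := 0) (b := 2 * Real.pi)
    (fun t _ => hd t)
    ((by fun_prop : Continuous fun t =>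
      dslope f z (γ t) * (I * (ρ t * unitNormal t))).intervalIntegrable _ _)
  have hp := h.periodic 0
  rw [zero_add] at hp
  rw [hp, sub_self] at hint
  have hpi : (Real.pi : ℂ) ≠ 0 := by exact_mod_cast Real.pi_ne_zero
  have h1 : ∀ t, f (γ t) * lengthElement ρ t / (γ t - z) =
      (2 * Real.pi * I)⁻¹ * (dslope f z (γ t) * (I * (ρ t * unitNormal t))) +
        f z * (lengthElement ρ t / (γ t - z)) := by
    intro t
    have h2 := hne t
    have := I_ne_zero
    rw [dslope_of_ne _ (sub_ne_zero.1 h2), slope_def_field]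
    unfold lengthElement
    field_simp
    ring
  have hc2 : Continuous fun t => lengthElement ρ t / (γ t - z) := hk.div (by fun_prop) hne
  simp only [h1]
  rw [intervalIntegral.integral_add, intervalIntegral.integral_const_mul,
    intervalIntegral.integral_const_mul, hint, h.integral_logDeriv hz]
  · simp
  · exact (by fun_prop : Continuous fun t => (2 * Real.pi * I)⁻¹ *
      (dslope f z (γ t) * (I * (ρ t * unitNormal t)))).intervalIntegrable _ _
  · exact (continuous_const.mul hc2).intervalIntegrable _ _

/-! ### Double layer potentials and boundary estimates for Cauchy transforms -/

theorem continuousOn_kernel (h : IsSupportCurve γ ρ) {z : ℂ} {s : Set ℝ}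
    (hz : ∀ t ∈ s, γ t ≠ z) : ContinuousOn (fun t => lengthElement ρ t / (γ t - z)) s :=
  h.continuous_lengthElement.continuousOn.div (h.continuous.sub continuous_const).continuousOn
    fun t ht => sub_ne_zero.2 (hz t ht)

theorem continuousOn_doubleLayer (h : IsSupportCurve γ ρ) {z : ℂ} {s : Set ℝ}
    (hz : ∀ t ∈ s, γ t ≠ z) : ContinuousOn (doubleLayer γ ρ z) s :=
  continuous_re.comp_continuousOn (continuousOn_const.mul (h.continuousOn_kernel hz))

theorem continuous_doubleLayer (h : IsSupportCurve γ ρ) {z : ℂ} (hz : z ∈ enclosed γ) :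
    Continuous (doubleLayer γ ρ z) :=
  continuousOn_univ.1 (h.continuousOn_doubleLayer fun t _ =>
    sub_ne_zero.1 (sub_ne_zero_of_mem_enclosed hz t))

theorem integral_doubleLayer_eq (h : IsSupportCurve γ ρ) {z : ℂ} {a b : ℝ}
    (hz : ∀ t ∈ uIcc a b, γ t ≠ z) :
    ∫ t in a..b, doubleLayer γ ρ z t =
      (2 * ∫ t in a..b, lengthElement ρ t / (γ t - z)).re := by
  rw [← intervalIntegral.integral_const_mul]
  exact reCLM.intervalIntegral_comp_comm
    (continuousOn_const.mul (h.continuousOn_kernel hz)).intervalIntegrable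

theorem integral_doubleLayer (h : IsSupportCurve γ ρ) {z : ℂ} (hz : z ∈ enclosed γ) :
    ∫ t in (0 : ℝ)..2 * Real.pi, doubleLayer γ ρ z t = 2 := by
  rw [h.integral_doubleLayer_eq fun t _ => sub_ne_zero.1 (sub_ne_zero_of_mem_enclosed hz t),
    h.integral_logDeriv hz]
  simp

theorem doubleLayer_periodic (h : IsSupportCurve γ ρ) (z : ℂ) :
    Function.Periodic (doubleLayer γ ρ z) (2 * Real.pi) := fun t => by
  simp only [doubleLayer, lengthElement, h.periodic t, h.radius_periodic t, unitNormal_periodic t]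

/-- Seen from a point of the curve, the rest of the curve fills an angle of at most `π`. -/
theorem integral_doubleLayer_boundary_le (h : IsSupportCurve γ ρ) (s : ℝ) {a b : ℝ}
    (hab : uIcc a b ⊆ Ioo s (s + 2 * Real.pi)) :
    ∫ t in a..b, doubleLayer γ ρ (γ s) t ≤ 1 := by
  have hre : ∀ t ∈ uIcc a b, 0 < (-((γ t - γ s) * conj (unitNormal s))).re := fun t ht => by
    rw [neg_re]; exact neg_pos.2 (h.re_chord_neg (hab ht))
  have hne : ∀ t ∈ uIcc a b, γ t - γ s ≠ 0 := fun t ht h0 => by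
    have := hre t ht
    simp [h0] at this
  -- The chord from `γ s`, turned by the inner normal, has principal argument in `[-π/2, π/2]`. The
  -- primitive `L` therefore varies by at most 1.
  set L : ℝ → ℝ := fun t => (log (-((γ t - γ s) * conj (unitNormal s)))).im / Real.pi with hL
  have hd : ∀ t ∈ uIcc a b, HasDerivAt L (doubleLayer γ ρ (γ s) t) t := by
    intro t ht
    have h1 := ((((h.hasDerivAt t).sub_const (γ s)).mul_const (conj (unitNormal s))).neg).clog_real
      (Or.inl (hre t ht))
    have h2 := (imCLM.hasFDerivAt.comp_hasDerivAt t h1).div_const Real.pi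
    convert! h2 using 1
    rw [doubleLayer_eq, imCLM_apply, Pi.neg_apply, neg_div_neg_eq,
      mul_div_mul_right _ _ (conj_unitNormal_ne_zero s)]
  rw [intervalIntegral.integral_eq_sub_of_hasDerivAt hd
    (h.continuousOn_doubleLayer fun t ht => sub_ne_zero.1 (hne t ht)).intervalIntegrable]
  have hb := abs_le.1 (abs_arg_le_pi_div_two_iff.2 (hre b right_mem_uIcc).le)
  have ha := abs_le.1 (abs_arg_le_pi_div_two_iff.2 (hre a left_mem_uIcc).le)
  simp only [hL, log_im]
  rw [← sub_div, div_le_one Real.pi_pos]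
  linarith [hb.2, ha.1]

/-- Boundary behaviour of the mass of the double layer potential away from a boundary point. -/
theorem eventually_integral_doubleLayer_lt (h : IsSupportCurve γ ρ) (s : ℝ) {a b ε : ℝ}
    (hab : uIcc a b ⊆ Ioo s (s + 2 * Real.pi)) (hε : 0 < ε) :
    ∀ᶠ z in 𝓝 (γ s), ∫ t in a..b, doubleLayer γ ρ z t < 1 + ε := by
  have hcl : IsClosed (γ '' uIcc a b) := (isCompact_uIcc.image h.continuous).isClosed
  have hs : γ s ∈ (γ '' uIcc a b)ᶜ := by
    rintro ⟨t, ht, hts⟩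
    have := h.re_chord_neg (hab ht)
    simp [hts] at this
  have hV := hcl.isOpen_compl
  have hmem : ∀ {z : ℂ}, z ∈ (γ '' uIcc a b)ᶜ → ∀ t ∈ uIcc a b, γ t ≠ z := fun hz t ht h0 =>
    hz ⟨t, ht, h0⟩
  have hc : ContinuousAt (fun z => (2 * ∫ t in a..b, lengthElement ρ t / (γ t - z)).re) (γ s) := by
    have := (differentiableOn_cauchyTransform (a := a) (b := b) hV h.continuous
      h.continuous_lengthElement fun t ht h0 => h0 ⟨t, ht, rfl⟩).continuousOn.continuousAt
      (hV.mem_nhds hs)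
    exact continuous_re.continuousAt.comp (continuousAt_const.mul this)
  have hlt : (2 * ∫ t in a..b, lengthElement ρ t / (γ t - γ s)).re < 1 + ε := by
    rw [← h.integral_doubleLayer_eq (hmem hs)]
    linarith [h.integral_doubleLayer_boundary_le s hab]
  filter_upwards [hc.eventually (gt_mem_nhds hlt), hV.mem_nhds hs] with z hz hzV
  rwa [h.integral_doubleLayer_eq (hmem hzV)]

/-- Near the boundary, the double layer potential minus the boundary value is almost bounded by
the supremum of the data. -/
theorem eventually_norm_doubleLayer_sub_le (h : IsSupportCurve γ ρ) {f : ℂ → ℂ} {M : ℝ} (s : ℝ)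
    (hfγ : Continuous fun t => f (γ t)) (hfs : ContinuousAt f (γ s))
    (hM : ∀ t, ‖f (γ t)‖ ≤ M) (hM' : ∀ z ∈ enclosed γ, ‖f z‖ ≤ M) {ε : ℝ} (hε : 0 < ε) :
    ∀ᶠ z in 𝓝 (γ s), z ∈ enclosed γ →
      ‖(∫ t in (0 : ℝ)..2 * Real.pi, f (γ t) * doubleLayer γ ρ z t) - f z‖ ≤ M + ε := by
  have hM0 : 0 ≤ M := (norm_nonneg _).trans (hM 0)
  -- The near arc costs `2δ` times a mass at most 2, and the excess mass costs `2δM`; together these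
  -- make `ε`.
  set δ := ε / (4 + 2 * M) with hδ
  have hδ0 : 0 < δ := by positivity
  have hδε : 4 * δ + 2 * δ * M = ε := by
    rw [hδ]; field_simp
  obtain ⟨η, hη0, hηπ, hη⟩ : ∃ η > 0, η < Real.pi ∧ ∀ t ∈ Icc (s - η) (s + η),
      ‖f (γ t) - f (γ s)‖ ≤ δ := by
    obtain ⟨r, hr, hr'⟩ := Metric.continuousAt_iff.1 (hfγ.continuousAt (x := s)) δ hδ0
    refine ⟨min (r / 2) (Real.pi / 2), by positivity, ?_, fun t ht => ?_⟩
    · linarith [min_le_right (r / 2) (Real.pi / 2), Real.pi_pos]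
    · rw [← dist_eq_norm]
      refine (hr' ?_).le
      rw [Real.dist_eq, abs_lt]
      constructor <;> linarith [ht.1, ht.2, min_le_left (r / 2) (Real.pi / 2)]
  have hle : s + η ≤ s + (2 * Real.pi - η) := by linarith
  have hfar := h.eventually_integral_doubleLayer_lt s (a := s + η) (b := s + (2 * Real.pi - η))
    (ε := δ) (by
      rw [uIcc_of_le hle]
      exact fun t ht => ⟨by linarith [ht.1], by linarith [ht.2]⟩) hδ0
  have hfs' : ∀ᶠ z in 𝓝 (γ s), ‖f z - f (γ s)‖ < δ := by
    simpa [dist_eq_norm] using Metric.continuousAt_iff'.1 hfs δ hδ0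
  filter_upwards [hfar, hfs'] with z hzfar hzs hz
  have hμ := h.continuous_doubleLayer hz
  have hμC : Continuous fun t => ((doubleLayer γ ρ z t : ℝ) : ℂ) := continuous_ofReal.comp hμ
  have hμ0 := h.doubleLayer_pos hz
  set far := ∫ t in (s + η)..(s + (2 * Real.pi - η)), doubleLayer γ ρ z t with hfar_def
  set near := ∫ t in (s - η)..(s + η), doubleLayer γ ρ z t with hnear_def
  have hper := h.doubleLayer_periodic z
  have hend : s - η + 2 * Real.pi = s + (2 * Real.pi - η) := by ring
  have hsum : near + far = 2 := by
    rw [hnear_def, hfar_def, intervalIntegral.integral_add_adjacent_intervals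
      (hμ.intervalIntegrable _ _) (hμ.intervalIntegrable _ _), ← hend,
      hper.intervalIntegral_add_eq _ 0, zero_add, h.integral_doubleLayer hz]
  have hfar0 : 0 ≤ far := intervalIntegral.integral_nonneg hle fun t _ => (hμ0 t).le
  have hnear0 : 0 ≤ near := intervalIntegral.integral_nonneg (by linarith) fun t _ => (hμ0 t).le
  have hperf : Function.Periodic (fun t => f (γ t) * (doubleLayer γ ρ z t : ℂ)) (2 * Real.pi) :=
    fun t => by simp only [h.periodic t, hper t]
  have hfμ : Continuous fun t => f (γ t) * (doubleLayer γ ρ z t : ℂ) := hfγ.mul hμC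
  -- On the near arc `f (γ t)` is replaced by `f z`, leaving the coefficient `near - 1` in front of
  -- `f z`.
  have hdecomp : (∫ t in (0 : ℝ)..2 * Real.pi, f (γ t) * doubleLayer γ ρ z t) - f z =
      (∫ t in (s - η)..(s + η), (f (γ t) - f z) * doubleLayer γ ρ z t) +
      (∫ t in (s + η)..(s + (2 * Real.pi - η)), f (γ t) * doubleLayer γ ρ z t) +
      (near - 1 : ℝ) * f z := by
    have h1 := hperf.intervalIntegral_add_eq 0 (s - η)
    rw [zero_add, hend, ← intervalIntegral.integral_add_adjacent_intervals (a := s - η) (b := s + η)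
      (hfμ.intervalIntegrable _ _) (hfμ.intervalIntegrable _ _)] at h1
    have hzμ : Continuous fun t => f z * (doubleLayer γ ρ z t : ℂ) := continuous_const.mul hμC
    simp only [sub_mul]
    rw [h1, intervalIntegral.integral_sub (hfμ.intervalIntegrable _ _)
      (hzμ.intervalIntegrable _ _), intervalIntegral.integral_const_mul,
      intervalIntegral.integral_ofReal]
    push_cast
    ring
  have hnearb : ‖∫ t in (s - η)..(s + η), (f (γ t) - f z) * doubleLayer γ ρ z t‖ ≤
      2 * δ * near := by
    rw [hnear_def, ← intervalIntegral.integral_const_mul]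
    refine intervalIntegral.norm_integral_le_of_norm_le (by linarith)
      (Filter.Eventually.of_forall fun t ht => ?_)
      ((continuous_const.mul hμ).intervalIntegrable _ _)
    rw [norm_mul, norm_real, Real.norm_of_nonneg (hμ0 t).le]
    refine mul_le_mul_of_nonneg_right ?_ (hμ0 t).le
    calc ‖f (γ t) - f z‖ = ‖(f (γ t) - f (γ s)) - (f z - f (γ s))‖ := by congr 1; ring
      _ ≤ ‖f (γ t) - f (γ s)‖ + ‖f z - f (γ s)‖ := norm_sub_le _ _
      _ ≤ 2 * δ := by linarith [hη t ⟨ht.1.le, ht.2⟩]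
  have hfarb : ‖∫ t in (s + η)..(s + (2 * Real.pi - η)), f (γ t) * doubleLayer γ ρ z t‖ ≤
      M * far := by
    rw [hfar_def, ← intervalIntegral.integral_const_mul]
    refine intervalIntegral.norm_integral_le_of_norm_le hle
      (Filter.Eventually.of_forall fun t ht => ?_)
      ((continuous_const.mul hμ).intervalIntegrable _ _)
    rw [norm_mul, norm_real, Real.norm_of_nonneg (hμ0 t).le]
    exact mul_le_mul_of_nonneg_right (hM t) (hμ0 t).le
  have hlast : ‖((near - 1 : ℝ) : ℂ) * f z‖ ≤ |near - 1| * M := by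
    rw [norm_mul, norm_real, Real.norm_eq_abs]
    exact mul_le_mul_of_nonneg_left (hM' z hz) (abs_nonneg _)
  -- With `near + far = 2`, the left side is 1 if `near ≥ 1`, and otherwise `2 far - 1`, where `far
  -- < 1 + δ`.
  have hmass : far + |near - 1| ≤ 1 + 2 * δ := by
    rcases abs_cases (near - 1) with ⟨h1, _⟩ | ⟨h1, _⟩ <;> rw [h1] <;> linarith
  rw [hdecomp]
  calc _ ≤ 2 * δ * near + M * far + |near - 1| * M :=
        (norm_add₃_le).trans (add_le_add (add_le_add hnearb hfarb) hlast)
    _ ≤ 2 * δ * 2 + M * (1 + 2 * δ) := by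
        have h1 : 2 * δ * near ≤ 2 * δ * 2 := by gcongr; linarith
        have h2 := mul_le_mul_of_nonneg_left hmass hM0
        linarith
    _ = M + ε := by rw [← hδε]; ring

/-- The conjugate of the Cauchy transform of `conj f` is a double layer potential. -/
theorem conj_cauchyTransform_conj (h : IsSupportCurve γ ρ) {U : Set ℂ} (hU : IsOpen U)
    (hUc : Convex ℝ U) (hγU : ∀ t, γ t ∈ U) {f : ℂ → ℂ} (hf : DifferentiableOn ℂ f U) {z : ℂ}
    (hz : z ∈ enclosed γ) (hzU : z ∈ U) :
    conj (∫ t in (0 : ℝ)..2 * Real.pi, conj (f (γ t)) * lengthElement ρ t / (γ t - z)) =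
      (∫ t in (0 : ℝ)..2 * Real.pi, f (γ t) * doubleLayer γ ρ z t) - f z := by
  have hne := sub_ne_zero_of_mem_enclosed hz
  have hγ := h.continuous
  have hk := h.continuous_lengthElement
  have hfc : Continuous fun t => f (γ t) := hf.continuousOn.comp_continuous hγ hγU
  have hμC : Continuous fun t => ((doubleLayer γ ρ z t : ℝ) : ℂ) :=
    continuous_ofReal.comp (h.continuous_doubleLayer hz)
  conv_rhs => rw [h.cauchy_formula hU hUc hγU hf hz hzU]
  rw [← intervalIntegral.integral_sub]
  · rw [← intervalIntegral.intervalIntegral_conj]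
    refine intervalIntegral.integral_congr fun t _ => ?_
    -- The double layer density is the Cauchy kernel plus its conjugate; removing the kernel part,
    -- which integrates to `f z`, leaves the conjugated transform.
    have h1 : ((doubleLayer γ ρ z t : ℝ) : ℂ) = lengthElement ρ t / (γ t - z) +
        conj (lengthElement ρ t / (γ t - z)) := by
      rw [add_conj, doubleLayer]
      norm_num
    simp only [h1, mul_div_assoc, map_mul, conj_conj]
    ring
  · exact (hfc.mul hμC).intervalIntegrable _ _
  · exact ((hfc.mul hk).div (by fun_prop) hne).intervalIntegrable _ _

/-- The Cauchy transform of the conjugate of a holomorphic function is bounded by its supremum. -/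
theorem norm_cauchyTransform_conj_le (h : IsSupportCurve γ ρ) {U : Set ℂ} (hU : IsOpen U)
    (hUc : Convex ℝ U) (hγU : ∀ t, γ t ∈ U) (hsub : enclosed γ ⊆ U) {f : ℂ → ℂ}
    (hf : DifferentiableOn ℂ f U) {M : ℝ} (hM : ∀ z ∈ U, ‖f z‖ ≤ M) {z : ℂ}
    (hz : z ∈ enclosed γ) :
    ‖∫ t in (0 : ℝ)..2 * Real.pi, conj (f (γ t)) * lengthElement ρ t / (γ t - z)‖ ≤ M := by
  set g : ℂ → ℂ := fun z => ∫ t in (0 : ℝ)..2 * Real.pi,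
    conj (f (γ t)) * lengthElement ρ t / (γ t - z) with hg
  have hfc : Continuous fun t => f (γ t) := hf.continuousOn.comp_continuous h.continuous hγU
  have hk := h.continuous_lengthElement
  have hgd : DifferentiableOn ℂ g (enclosed γ) :=
    differentiableOn_cauchyTransform h.isOpen_enclosed h.continuous
      ((continuous_conj.comp hfc).mul hk) fun t _ => notMem_enclosed γ t
  change ‖g z‖ ≤ M
  refine le_of_forall_pos_le_add fun ε hε => ?_
  have hbd : ∀ x ∈ frontier (enclosed γ), ∀ᶠ w in 𝓝 x, w ∈ enclosed γ → ‖g w‖ ≤ M + ε / 2 := by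
    intro x hx
    obtain ⟨s, rfl⟩ := h.frontier_enclosed_subset hx
    filter_upwards [h.eventually_norm_doubleLayer_sub_le s hfc
      (hf.continuousOn.continuousAt (hU.mem_nhds (hγU s))) (fun t => hM _ (hγU t))
      (fun w hw => hM w (hsub hw)) (half_pos hε)] with w hw hwe
    rw [← norm_conj, hg, h.conj_cauchyTransform_conj hU hUc hγU hf hwe (hsub hwe)]
    exact hw hwe
  by_contra! hcon
  -- The bound `M + ε / 2` near the frontier keeps the closure of this superlevel set inside the
  -- region. The maximum principle on `W` then needs no boundary values of `g`.
  set W : Set ℂ := {w | w ∈ enclosed γ ∧ M + ε < ‖g w‖} with hW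
  have hWcl : closure W ⊆ {w | w ∈ enclosed γ ∧ M + ε ≤ ‖g w‖} := by
    intro x hx
    have hxc : x ∈ closure (enclosed γ) := closure_mono (fun w hw => hw.1) hx
    have hxe : x ∈ enclosed γ := by
      by_contra hxe
      have hfr : x ∈ frontier (enclosed γ) := by
        rw [h.isOpen_enclosed.frontier_eq]; exact ⟨hxc, hxe⟩
      obtain ⟨w, hw1, hw2⟩ := mem_closure_iff_frequently.1 hx |>.and_eventually (hbd x hfr) |>.exists
      linarith [hw2 hw1.1, hw1.2]
    refine ⟨hxe, ?_⟩
    have hca : ContinuousAt (fun w => ‖g w‖) x :=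
      (hgd.continuousOn.continuousAt (h.isOpen_enclosed.mem_nhds hxe)).norm
    by_contra! hlt
    obtain ⟨w, hw1, hw2⟩ := mem_closure_iff_frequently.1 hx |>.and_eventually
      (hca.eventually (gt_mem_nhds hlt)) |>.exists
    linarith [hw1.2]
  have hWo : IsOpen W := by
    have := hgd.continuousOn.norm.isOpen_inter_preimage h.isOpen_enclosed (isOpen_Ioi (a := M + ε))
    exact this
  have hfrW : ∀ w ∈ frontier W, ‖g w‖ ≤ M + ε := by
    intro w hw
    rw [hWo.frontier_eq] at hw
    by_contra! hlt
    exact hw.2 ⟨(hWcl hw.1).1, hlt⟩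
  have := norm_le_of_forall_mem_frontier_norm_le (h.isBounded_enclosed.subset fun w hw => hw.1)
    ((hgd.mono fun w hw => (hWcl hw).1).diffContOnCl) hfrW (subset_closure (⟨hz, hcon⟩ : z ∈ W))
  linarith

end IsSupportCurve

/-! ### Smooth convex curves between a compact convex set and a convex neighbourhood -/

/-- A point outside `U` is separated from `U` by a real functional `w ↦ Re (w conj u)`. At the curve
point whose normal has the direction of `u`, the separation contradicts the defining inequality of
the enclosed region. -/
theorem enclosed_subset {γ : ℝ → ℂ} {U : Set ℂ} (hU : IsOpen U) (hUc : Convex ℝ U)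
    (hγU : ∀ t, γ t ∈ U) : enclosed γ ⊆ U := by
  intro z hz
  by_contra hzU
  obtain ⟨φ, hφ⟩ := geometric_hahn_banach_open_point hUc hU hzU
  have hrep : ∀ w, φ w = (w * conj (φ 1 + φ I * I)).re := by
    intro w
    have h1 : w = w.re • (1 : ℂ) + w.im • I := by
      simp [real_smul, re_add_im]
    conv_lhs => rw [h1]
    rw [map_add, map_smul, map_smul]
    simp only [map_add, map_mul, conj_ofReal, conj_I, mul_re, add_re, add_im, mul_im, ofReal_re,
      ofReal_im, neg_re, neg_im, I_re, I_im, smul_eq_mul]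
    ring
  set u : ℂ := φ 1 + φ I * I with hu
  obtain ⟨t, ht⟩ : ∃ t, u = ‖u‖ * unitNormal t := ⟨arg u, (norm_mul_exp_arg_mul_I u).symm⟩
  have h1 := hφ _ (hγU t)
  have h2 := hz t
  have h3 : φ (γ t) - φ z = ‖u‖ * ((γ t - z) * conj (unitNormal t)).re := by
    rw [← map_sub, hrep, ← re_ofReal_mul]
    congr 1
    conv_lhs => rw [ht]
    rw [map_mul, conj_ofReal]
    ring
  have h4 : 0 ≤ ‖u‖ * ((γ t - z) * conj (unitNormal t)).re := by positivity
  linarith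

/-- A `C²` support function with positive radius of curvature defines a convex curve. -/
theorem isSupportCurve_of_support {h h' h'' : ℝ → ℝ} (hd : ∀ t, HasDerivAt h (h' t) t)
    (hd' : ∀ t, HasDerivAt h' (h'' t) t) (hc : Continuous h'') (hpos : ∀ t, 0 < h t + h'' t)
    (hp : Function.Periodic h (2 * Real.pi)) (hp' : Function.Periodic h' (2 * Real.pi))
    (hp'' : Function.Periodic h'' (2 * Real.pi)) :
    IsSupportCurve (fun t => unitNormal t * (h t + h' t * I)) (fun t => h t + h'' t) where
  continuous_radius := (continuous_iff_continuousAt.2 fun t => (hd t).continuousAt).add hc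
  radius_pos := hpos
  hasDerivAt t := by
    have := (hasDerivAt_unitNormal t).mul ((hd t).ofReal_comp.add ((hd' t).ofReal_comp.mul_const I))
    convert! this using 1
    simp only [Pi.add_apply]
    push_cast
    linear_combination (-unitNormal t * h' t) * I_mul_I
  periodic t := by simp only [unitNormal_periodic t, hp t, hp' t]
  radius_periodic t := by simp only [hp t, hp'' t]

/-! ### Log-sum-exp smoothing of a support function -/

section SoftSupport

variable (s : Finset ℂ) (β c : ℝ)

/-- The coordinate of `v` along the normal of angle `t`. -/
noncomputable def normalCoord (v : ℂ) (t : ℝ) : ℝ := (v * conj (unitNormal t)).re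

/-- The coordinate of `v` along the tangent at angle `t`. -/
noncomputable def tangentCoord (v : ℂ) (t : ℝ) : ℝ := (v * conj (unitNormal t)).im

theorem hasDerivAt_mul_conj_unitNormal (v : ℂ) (t : ℝ) :
    HasDerivAt (fun t => v * conj (unitNormal t)) (-I * (v * conj (unitNormal t))) t := by
  have := (hasDerivAt_conj_unitNormal t).const_mul v
  convert! this using 1
  ring

theorem hasDerivAt_normalCoord (v : ℂ) (t : ℝ) :
    HasDerivAt (normalCoord v) (tangentCoord v t) t := by
  have := reCLM.hasFDerivAt.comp_hasDerivAt t (hasDerivAt_mul_conj_unitNormal v t)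
  convert! this using 1
  simp [tangentCoord]

theorem hasDerivAt_tangentCoord (v : ℂ) (t : ℝ) :
    HasDerivAt (tangentCoord v) (-normalCoord v t) t := by
  have := imCLM.hasFDerivAt.comp_hasDerivAt t (hasDerivAt_mul_conj_unitNormal v t)
  convert! this using 1
  simp [normalCoord]

@[fun_prop]
theorem continuous_normalCoord (v : ℂ) : Continuous (normalCoord v) :=
  continuous_iff_continuousAt.2 fun t => (hasDerivAt_normalCoord v t).continuousAt

@[fun_prop]
theorem continuous_tangentCoord (v : ℂ) : Continuous (tangentCoord v) :=
  continuous_iff_continuousAt.2 fun t => (hasDerivAt_tangentCoord v t).continuousAt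

theorem normalCoord_periodic (v : ℂ) : Function.Periodic (normalCoord v) (2 * Real.pi) :=
  fun t => by simp only [normalCoord, unitNormal_periodic t]

theorem tangentCoord_periodic (v : ℂ) : Function.Periodic (tangentCoord v) (2 * Real.pi) :=
  fun t => by simp only [tangentCoord, unitNormal_periodic t]

/-- The Gibbs weight of `v` in the direction of angle `t`. -/
noncomputable def gibbs (v : ℂ) (t : ℝ) : ℝ := Real.exp (β * normalCoord v t)

theorem gibbs_pos (v : ℂ) (t : ℝ) : 0 < gibbs β v t := Real.exp_pos _

theorem hasDerivAt_gibbs (v : ℂ) (t : ℝ) :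
    HasDerivAt (gibbs β v) (β * (gibbs β v t * tangentCoord v t)) t := by
  have := ((hasDerivAt_normalCoord v t).const_mul β).exp
  convert! this using 1
  simp only [gibbs]
  ring

/-- The partition function of the points of `s`. -/
noncomputable def partition (t : ℝ) : ℝ := ∑ v ∈ s, gibbs β v t

/-- A smooth approximation to the support function of the convex hull of `s`. -/
noncomputable def softSupport (t : ℝ) : ℝ := c + Real.log (partition s β t) / β

/-- The derivative of `softSupport`. -/
noncomputable def softSupportDeriv (t : ℝ) : ℝ :=
  (∑ v ∈ s, gibbs β v t * tangentCoord v t) / partition s β t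

/-- The second derivative of `softSupport`. -/
noncomputable def softSupportDeriv₂ (t : ℝ) : ℝ :=
  ((∑ v ∈ s, (β * (gibbs β v t * tangentCoord v t) * tangentCoord v t
    + gibbs β v t * -normalCoord v t)) * partition s β t -
    (∑ v ∈ s, gibbs β v t * tangentCoord v t) * (β * ∑ v ∈ s, gibbs β v t * tangentCoord v t)) /
    partition s β t ^ 2

variable {s β c}

theorem partition_pos (hs : s.Nonempty) (t : ℝ) : 0 < partition s β t :=
  Finset.sum_pos (fun v _ => gibbs_pos β v t) hs

theorem hasDerivAt_partition (t : ℝ) :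
    HasDerivAt (partition s β) (β * ∑ v ∈ s, gibbs β v t * tangentCoord v t) t := by
  rw [Finset.mul_sum]
  exact HasDerivAt.fun_sum fun v _ => hasDerivAt_gibbs β v t

theorem hasDerivAt_softSupport (hs : s.Nonempty) (hβ : 0 < β) (t : ℝ) :
    HasDerivAt (softSupport s β c) (softSupportDeriv s β t) t := by
  have := (((hasDerivAt_partition (s := s) (β := β) t).log
    (partition_pos hs t).ne').div_const β).const_add c
  convert! this using 1
  simp only [softSupportDeriv]
  field_simp

theorem hasDerivAt_softSupportDeriv (hs : s.Nonempty) (t : ℝ) :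
    HasDerivAt (softSupportDeriv s β) (softSupportDeriv₂ s β t) t :=
  (HasDerivAt.fun_sum fun v _ => (hasDerivAt_gibbs β v t).mul (hasDerivAt_tangentCoord v t)).div
    (hasDerivAt_partition t) (partition_pos hs t).ne'

theorem le_log_partition {v : ℂ} (hv : v ∈ s) (hβ : 0 < β) (t : ℝ) :
    normalCoord v t ≤ Real.log (partition s β t) / β := by
  rw [le_div_iff₀ hβ, mul_comm, ← Real.log_exp (β * normalCoord v t)]
  exact Real.log_le_log (Real.exp_pos _)
    (Finset.single_le_sum (f := fun v => gibbs β v t) (fun v _ => (gibbs_pos β v t).le) hv)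

theorem sum_gibbs_mul_normalCoord_le (hβ : 0 < β) (t : ℝ) :
    ∑ v ∈ s, gibbs β v t * normalCoord v t ≤
      partition s β t * (Real.log (partition s β t) / β) := by
  rw [partition, Finset.sum_mul]
  exact Finset.sum_le_sum fun v hv =>
    mul_le_mul_of_nonneg_left (le_log_partition hv hβ t) (gibbs_pos β v t).le

/-- The radius is `c` plus two nonnegative terms: the gap between the soft maximum and the Gibbs
mean of the normal coordinates, and `β` times the Gibbs variance of the tangential coordinates
(Cauchy–Schwarz). -/
theorem softSupport_radius_pos (hs : s.Nonempty) (hβ : 0 < β) (hc : 0 < c) (t : ℝ) :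
    0 < softSupport s β c t + softSupportDeriv₂ s β t := by
  have hS := partition_pos (β := β) hs t
  have h1 := sum_gibbs_mul_normalCoord_le (s := s) hβ t
  have h2 : (∑ v ∈ s, gibbs β v t * tangentCoord v t) ^ 2 ≤
      partition s β t * ∑ v ∈ s, gibbs β v t * tangentCoord v t ^ 2 :=
    Finset.sum_sq_le_sum_mul_sum_of_sq_le_mul _ (fun v _ => (gibbs_pos β v t).le)
      (fun v _ => mul_nonneg (gibbs_pos β v t).le (sq_nonneg _)) fun v _ => le_of_eq (by ring)
  have h3 : ∑ v ∈ s, (β * (gibbs β v t * tangentCoord v t) * tangentCoord v t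
      + gibbs β v t * -normalCoord v t) = β * (∑ v ∈ s, gibbs β v t * tangentCoord v t ^ 2) -
      ∑ v ∈ s, gibbs β v t * normalCoord v t := by
    rw [Finset.mul_sum, ← Finset.sum_sub_distrib]
    exact Finset.sum_congr rfl fun v _ => by ring
  rw [softSupport, softSupportDeriv₂, h3]
  set S := partition s β t
  set X := ∑ v ∈ s, gibbs β v t * normalCoord v t
  set Y := ∑ v ∈ s, gibbs β v t * tangentCoord v t
  set Z := ∑ v ∈ s, gibbs β v t * tangentCoord v t ^ 2
  have h4 : c + Real.log S / β + ((β * Z - X) * S - Y * (β * Y)) / S ^ 2 =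
      c + ((S * (Real.log S / β) - X) * S + β * (S * Z - Y ^ 2)) / S ^ 2 := by
    field_simp
    ring
  rw [h4]
  have h5 := mul_nonneg (sub_nonneg.2 h1) hS.le
  have h6 := mul_nonneg hβ.le (sub_nonneg.2 h2)
  positivity

theorem isSupportCurve_softSupport (hs : s.Nonempty) (hβ : 0 < β) (hc : 0 < c) :
    IsSupportCurve (fun t => unitNormal t * (softSupport s β c t + softSupportDeriv s β t * I))
      (fun t => softSupport s β c t + softSupportDeriv₂ s β t) := by
  have hg : ∀ v, Continuous (gibbs β v) := fun v => by unfold gibbs; fun_prop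
  have hp : Continuous (partition s β) := by unfold partition; fun_prop
  refine isSupportCurve_of_support (hasDerivAt_softSupport hs hβ) (hasDerivAt_softSupportDeriv hs)
    ?_ (softSupport_radius_pos hs hβ hc) ?_ ?_ ?_
  · unfold softSupportDeriv₂
    exact Continuous.div (by fun_prop) (by fun_prop) fun t => pow_ne_zero 2 (partition_pos hs t).ne'
  all_goals
    intro t
    simp only [softSupport, softSupportDeriv, softSupportDeriv₂, partition, gibbs,
      normalCoord_periodic _ t, tangentCoord_periodic _ t]

/-- The tangential coordinate of the curve is the Gibbs mean of the tangential coordinates, so the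
curve differs from the Gibbs barycentre, a point of the convex hull of `s`, only along the normal.
-/
theorem softSupport_curve_sub (hs : s.Nonempty) (t : ℝ) :
    unitNormal t * (softSupport s β c t + softSupportDeriv s β t * I) -
      ∑ v ∈ s, (gibbs β v t / partition s β t) • v =
    unitNormal t * ((softSupport s β c t -
      (∑ v ∈ s, gibbs β v t * normalCoord v t) / partition s β t : ℝ) : ℂ) := by
  have hS : (partition s β t : ℂ) ≠ 0 := by exact_mod_cast (partition_pos (β := β) hs t).ne'
  have h1 : ∀ v : ℂ, v = unitNormal t * (normalCoord v t + tangentCoord v t * I) := by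
    intro v
    rw [normalCoord, tangentCoord, re_add_im]
    linear_combination (-v) * unitNormal_mul_conj t
  have h2 : ∑ v ∈ s, (gibbs β v t / partition s β t) • v = unitNormal t *
      (((∑ v ∈ s, gibbs β v t * normalCoord v t) / partition s β t : ℝ) +
        (softSupportDeriv s β t) * I) := by
    simp only [softSupportDeriv]
    push_cast
    rw [Finset.sum_div, Finset.sum_div, Finset.sum_mul, ← Finset.sum_add_distrib, Finset.mul_sum]
    refine Finset.sum_congr rfl fun v _ => ?_
    refine (congrArg _ (h1 v)).trans ?_
    rw [real_smul]
    push_cast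
    ring
  rw [h2]
  push_cast
  ring

theorem softSupport_sub_nonneg (hs : s.Nonempty) (hβ : 0 < β) (hc : 0 < c) (t : ℝ) :
    0 ≤ softSupport s β c t -
      (∑ v ∈ s, gibbs β v t * normalCoord v t) / partition s β t := by
  have h := sum_gibbs_mul_normalCoord_le (s := s) hβ t
  rw [← div_le_iff₀' (partition_pos hs t)] at h
  rw [softSupport]
  linarith

/-- Up to `c`, the gap is the Gibbs entropy divided by `β`. The estimate `log x ≤ x - 1` bounds each
of its terms crudely, which is enough since `β` is free. -/
theorem softSupport_sub_le (hs : s.Nonempty) (hβ : 0 < β) (t : ℝ) :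
    softSupport s β c t - (∑ v ∈ s, gibbs β v t * normalCoord v t) / partition s β t ≤
      c + s.card / β := by
  have hS := partition_pos (β := β) hs t
  have h1 : ∀ v ∈ s, gibbs β v t * (Real.log (partition s β t) - β * normalCoord v t) ≤
      partition s β t := by
    intro v _
    have hg := gibbs_pos β v t
    have h2 : Real.log (partition s β t) - β * normalCoord v t =
        Real.log (partition s β t / gibbs β v t) := by
      rw [Real.log_div hS.ne' hg.ne', gibbs, Real.log_exp]
    have h3 := Real.log_le_sub_one_of_pos (div_pos hS hg)
    calc _ ≤ gibbs β v t * (partition s β t / gibbs β v t) := by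
          rw [h2]; exact mul_le_mul_of_nonneg_left (by linarith) hg.le
      _ = _ := by field_simp
  have h2 := Finset.sum_le_sum h1
  rw [Finset.sum_const, nsmul_eq_mul] at h2
  simp only [mul_sub] at h2
  rw [Finset.sum_sub_distrib, ← Finset.sum_mul] at h2
  change partition s β t * _ - _ ≤ _ at h2
  have h3 : ∑ v ∈ s, gibbs β v t * (β * normalCoord v t) =
      β * ∑ v ∈ s, gibbs β v t * normalCoord v t := by
    rw [Finset.mul_sum]; exact Finset.sum_congr rfl fun v _ => by ring
  rw [h3] at h2
  rw [softSupport, add_sub_assoc, add_le_add_iff_left, div_sub_div _ _ hβ.ne' hS.ne',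
    div_le_div_iff₀ (by positivity) hβ]
  nlinarith [mul_le_mul_of_nonneg_right h2 hβ.le]

end SoftSupport

/-- Between a compact convex set and a convex neighbourhood there is a convex curve with
continuous positive radius of curvature. -/
theorem exists_isSupportCurve {K U : Set ℂ} (hK : IsCompact K) (hKc : Convex ℝ K)
    (hKne : K.Nonempty) (hU : IsOpen U) (hKU : K ⊆ U) :
    ∃ γ : ℝ → ℂ, ∃ ρ : ℝ → ℝ, IsSupportCurve γ ρ ∧ (∀ t, γ t ∈ U) ∧ K ⊆ enclosed γ := by
  obtain ⟨δ, hδ, hδU⟩ := hK.exists_thickening_subset_open hU hKU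
  set c := δ / 4 with hc
  have hc0 : 0 < c := by positivity
  obtain ⟨s', hs'K, hs'f, hs'cov⟩ := hK.finite_cover_balls hc0
  set s := hs'f.toFinset with hs_def
  have hsK : ∀ v ∈ s, v ∈ K := fun v hv => hs'K (hs'f.mem_toFinset.1 hv)
  have hcov : ∀ z ∈ K, ∃ v ∈ s, ‖z - v‖ < c := by
    intro z hz
    obtain ⟨v, hv, hzv⟩ := mem_iUnion₂.1 (hs'cov hz)
    exact ⟨v, hs'f.mem_toFinset.2 hv, by rwa [← dist_eq_norm]⟩
  have hs : s.Nonempty := by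
    obtain ⟨z, hz⟩ := hKne
    obtain ⟨v, hv, _⟩ := hcov z hz
    exact ⟨v, hv⟩
  have hcard : (0 : ℝ) < s.card := by exact_mod_cast hs.card_pos
  -- This makes the smoothing error `c`, so the curve stays within `2c = δ / 2` of `K`.
  set β : ℝ := s.card / c with hβ_def
  have hβ : 0 < β := by positivity
  refine ⟨_, _, isSupportCurve_softSupport hs hβ hc0, fun t => hδU ?_, fun z hz t => ?_⟩
  · have hS := partition_pos (β := β) hs t
    rw [Metric.mem_thickening_iff]
    refine ⟨∑ v ∈ s, (gibbs β v t / partition s β t) • v, hKc.sum_mem (fun v _ => ?_) ?_ hsK, ?_⟩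
    · exact (div_pos (gibbs_pos β v t) hS).le
    · rw [← Finset.sum_div]; exact div_self hS.ne'
    · rw [dist_eq_norm, softSupport_curve_sub hs, norm_mul, norm_unitNormal, one_mul, norm_real,
        Real.norm_of_nonneg (softSupport_sub_nonneg hs hβ hc0 t)]
      refine (softSupport_sub_le hs hβ t).trans_lt ?_
      have : s.card / β = c := by rw [hβ_def]; field_simp
      rw [this, hc]
      linarith
  -- The shift `c` in the soft support compensates the distance, less than `c`, from `z` to the net
  -- point `v`.
  · obtain ⟨v, hv, hzv⟩ := hcov z hz
    have h1 : (unitNormal t * (softSupport s β c t + softSupportDeriv s β t * I) - z) *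
        conj (unitNormal t) = softSupport s β c t + softSupportDeriv s β t * I -
        v * conj (unitNormal t) - (z - v) * conj (unitNormal t) := by
      linear_combination (softSupport s β c t + softSupportDeriv s β t * I) * unitNormal_mul_conj t
    have h2 : ((z - v) * conj (unitNormal t)).re < c := by
      refine (re_le_norm _).trans_lt ?_
      rwa [norm_mul, norm_conj, norm_unitNormal, mul_one]
    have h3 := le_log_partition hv hβ t
    rw [h1, sub_re, sub_re, add_re, ofReal_re, re_ofReal_mul, I_re, mul_zero, add_zero]
    change 0 < _ - normalCoord v t - _
    rw [softSupport]
    linarith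

end CrouzeixPalencia

namespace CrouzeixPalencia

open scoped Matrix ComplexOrder

/-! ### Spectral norm estimates through sesquilinear forms -/

theorem sumSq_single {ν : Type*} [Fintype ν] [DecidableEq ν] (k : ν) :
    sumSq (Pi.single k 1 : ν → ℂ) = 1 := by
  rw [sumSq, Finset.sum_eq_single k (fun b _ hb => by simp [hb]) (by simp)]
  simp

theorem sum_sumSq_comm {ν μ : Type*} [Fintype ν] [Fintype μ] (z : ν → μ → ℂ) :
    ∑ j, sumSq (z j) = ∑ r, sumSq fun j => z j r := Finset.sum_comm

section SpectralNorm

variable {ι κ : Type*} [Fintype ι] [Fintype κ] [DecidableEq κ]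

/-- Cauchy–Schwarz followed by the inequality of means. The half sum of squares, unlike the product
of norms, can be summed over blocks and integrated. -/
theorem norm_star_dotProduct_mulVec_le (S : Matrix ι κ ℂ) (x : κ → ℂ) (y : ι → ℂ) :
    ‖star y ⬝ᵥ S.mulVec x‖ ≤ ‖S‖ * ((sumSq x + sumSq y) / 2) := by
  have h1 : star y ⬝ᵥ S.mulVec x = inner ℂ (WithLp.toLp 2 y) (WithLp.toLp 2 (S.mulVec x)) := by
    rw [EuclideanSpace.inner_eq_star_dotProduct, dotProduct_comm]
  have h2 := Matrix.l2_opNorm_mulVec S (WithLp.toLp 2 x)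
  have h3 := norm_inner_le_norm (𝕜 := ℂ) (WithLp.toLp 2 y) (WithLp.toLp 2 (S.mulVec x))
  rw [h1, ← norm_toLp_sq, ← norm_toLp_sq]
  set a := ‖WithLp.toLp 2 x‖
  set b := ‖WithLp.toLp 2 y‖ with hb
  have h4 : a * b ≤ (a ^ 2 + b ^ 2) / 2 := by linarith [two_mul_le_add_sq a b]
  calc _ ≤ b * (‖S‖ * a) := h3.trans (mul_le_mul_of_nonneg_left h2 (norm_nonneg _))
    _ = ‖S‖ * (a * b) := by ring
    _ ≤ _ := mul_le_mul_of_nonneg_left h4 (norm_nonneg _)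

theorem l2_opNorm_le_of_forall {S : Matrix ι κ ℂ} {C : ℝ} (hC : 0 ≤ C)
    (h : ∀ x y, ‖star y ⬝ᵥ S.mulVec x‖ ≤ C * ((sumSq x + sumSq y) / 2)) : ‖S‖ ≤ C := by
  rw [Matrix.l2_opNorm_def]
  refine ContinuousLinearMap.opNorm_le_bound _ hC fun x => ?_
  set T : EuclideanSpace ℂ ι := WithLp.toLp 2 (S.mulVec x.ofLp) with hT
  change ‖T‖ ≤ C * ‖x‖
  rcases eq_or_ne T 0 with h0 | h0
  · rw [h0, norm_zero]; positivity
  have ha : 0 < ‖T‖ := norm_pos_iff.2 h0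
  have hx0 : x ≠ 0 := by
    rintro rfl
    exact h0 (by simp [hT])
  have hb : 0 < ‖x‖ := norm_pos_iff.2 hx0
  -- Rescaling the test vector to the length of `x` makes the inequality of means an equality.
  have h1 := h x.ofLp (((‖x‖ / ‖T‖ : ℝ) : ℂ) • T.ofLp)
  have h2 : sumSq (((‖x‖ / ‖T‖ : ℝ) : ℂ) • T.ofLp) = ‖x‖ ^ 2 := by
    rw [← norm_toLp_sq, WithLp.toLp_smul, norm_smul, Complex.norm_real,
      Real.norm_of_nonneg (by positivity)]
    change (‖x‖ / ‖T‖ * ‖T‖) ^ 2 = _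
    rw [div_mul_cancel₀ _ ha.ne']
  have h3 : sumSq x.ofLp = ‖x‖ ^ 2 := (norm_toLp_sq _).symm
  have h4 : star T.ofLp ⬝ᵥ S.mulVec x.ofLp = ((‖T‖ ^ 2 : ℝ) : ℂ) := by
    have := star_dotProduct_self T.ofLp
    rwa [← norm_toLp_sq] at this
  rw [h2, h3, star_smul, smul_dotProduct, h4, smul_eq_mul, norm_mul, RCLike.star_def,
    Complex.conj_ofReal, Complex.norm_real, Complex.norm_real, Real.norm_of_nonneg (by positivity),
    Real.norm_of_nonneg (by positivity)] at h1
  have h5 : ‖x‖ / ‖T‖ * ‖T‖ ^ 2 = ‖x‖ * ‖T‖ := by field_simp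
  rw [h5] at h1
  refine le_of_mul_le_mul_left ?_ hb
  linarith

theorem norm_entry_le_l2_opNorm (S : Matrix ι κ ℂ) (i : ι) (j : κ) : ‖S i j‖ ≤ ‖S‖ := by
  classical
  have h := norm_star_dotProduct_mulVec_le S (Pi.single j 1) (Pi.single i 1)
  simpa [sumSq_single, ← Pi.single_star] using h

theorem l2_opNorm_le_of_norm_entry_le {S : Matrix ι κ ℂ} {B : ℝ} (hB : 0 ≤ B)
    (h : ∀ i j, ‖S i j‖ ≤ B) : ‖S‖ ≤ B * (Fintype.card ι + Fintype.card κ) := by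
  refine l2_opNorm_le_of_forall (by positivity) fun x y => ?_
  have hterm : ∀ i j, ‖star y i * (S i j * x j)‖ ≤ B * ((‖x j‖ ^ 2 + ‖y i‖ ^ 2) / 2) := by
    intro i j
    have h1 : ‖y i‖ * ‖x j‖ ≤ (‖x j‖ ^ 2 + ‖y i‖ ^ 2) / 2 := by
      linarith [two_mul_le_add_sq (‖y i‖) (‖x j‖)]
    calc _ = ‖S i j‖ * (‖y i‖ * ‖x j‖) := by
          rw [norm_mul, norm_mul, Pi.star_apply, norm_star]; ring
      _ ≤ B * (‖y i‖ * ‖x j‖) := by gcongr; exact h i j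
      _ ≤ _ := by gcongr
  calc ‖star y ⬝ᵥ S.mulVec x‖ = ‖∑ i, ∑ j, star y i * (S i j * x j)‖ := by
        simp only [dotProduct, Matrix.mulVec, Finset.mul_sum]
    _ ≤ ∑ i, ∑ j, B * ((‖x j‖ ^ 2 + ‖y i‖ ^ 2) / 2) :=
        (norm_sum_le _ _).trans (Finset.sum_le_sum fun i _ =>
          (norm_sum_le _ _).trans (Finset.sum_le_sum fun j _ => hterm i j))
    _ = B * ((Fintype.card ι * sumSq x + Fintype.card κ * sumSq y) / 2) := by
        simp only [← Finset.mul_sum, ← Finset.sum_div, Finset.sum_add_distrib, Finset.sum_const,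
          Finset.card_univ, nsmul_eq_mul, sumSq]
    _ ≤ B * (Fintype.card ι + Fintype.card κ) * ((sumSq x + sumSq y) / 2) := by
        have hx := sumSq_nonneg x
        have hy := sumSq_nonneg y
        rw [mul_assoc]
        refine mul_le_mul_of_nonneg_left ?_ hB
        have h1 : (0 : ℝ) ≤ Fintype.card ι * sumSq y := by positivity
        have h2 : (0 : ℝ) ≤ Fintype.card κ * sumSq x := by positivity
        linarith

/-- A Schur-type bound: `F ⊗ Q` is dominated by `‖F‖ (1 ⊗ Q)` for positive semidefinite `Q`. -/
theorem norm_kronecker_form_le {n : ℕ} (F : Matrix ι κ ℂ) {Q : Matrix (Fin n) (Fin n) ℂ}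
    (hQ : Q.PosSemidef) (x : κ × Fin n → ℂ) (y : ι × Fin n → ℂ) :
    ‖∑ i, ∑ j, F i j * (star (fun k => y (i, k)) ⬝ᵥ Q.mulVec fun l => x (j, l))‖ ≤
      ‖F‖ * (((∑ j, (star (fun k => x (j, k)) ⬝ᵥ Q.mulVec fun l => x (j, l)).re) +
        ∑ i, (star (fun k => y (i, k)) ⬝ᵥ Q.mulVec fun l => y (i, l)).re) / 2) := by
  obtain ⟨B, rfl⟩ : ∃ B : Matrix (Fin n) (Fin n) ℂ, Q = Bᴴ * B := by
    open scoped MatrixOrder in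
    obtain ⟨B, hB⟩ := CStarAlgebra.nonneg_iff_eq_star_mul_self.1 hQ.nonneg
    exact ⟨B, hB⟩
  have hB : ∀ u v : Fin n → ℂ, star u ⬝ᵥ (Bᴴ * B).mulVec v = star (B.mulVec u) ⬝ᵥ B.mulVec v := by
    intro u v
    rw [← Matrix.mulVec_mulVec, Matrix.dotProduct_mulVec, ← Matrix.star_mulVec]
  simp only [hB, star_dotProduct_self, Complex.ofReal_re]
  set x' : κ → Fin n → ℂ := fun j => B.mulVec fun l => x (j, l)
  set y' : ι → Fin n → ℂ := fun i => B.mulVec fun l => y (i, l)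
  -- After factoring `Q = Bᴴ B`, the form splits over the coordinates `r` into forms of `F` alone.
  have h1 : ∑ i, ∑ j, F i j * (star (y' i) ⬝ᵥ x' j) =
      ∑ r, star (fun i => y' i r) ⬝ᵥ F.mulVec fun j => x' j r := by
    simp only [dotProduct, Matrix.mulVec, Finset.mul_sum, Pi.star_apply]
    rw [Finset.sum_comm' (t' := Finset.univ) (s' := fun _ => Finset.univ) (by simp)]
    conv_rhs => rw [Finset.sum_comm]
    rw [Finset.sum_comm]
    refine Finset.sum_congr rfl fun i _ => ?_
    rw [Finset.sum_comm]
    exact Finset.sum_congr rfl fun r _ => Finset.sum_congr rfl fun j _ => by ring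
  change _ ≤ ‖F‖ * (((∑ j, sumSq (x' j)) + ∑ i, sumSq (y' i)) / 2)
  rw [h1, sum_sumSq_comm x', sum_sumSq_comm y', ← Finset.sum_add_distrib, Finset.sum_div, Finset.mul_sum]
  exact (norm_sum_le _ _).trans (Finset.sum_le_sum fun r _ =>
    norm_star_dotProduct_mulVec_le F _ _)

end SpectralNorm

/-! ### Resolvents -/

section Resolvent

open Complex

variable {n : ℕ} {A : Matrix (Fin n) (Fin n) ℂ} {γ : ℝ → ℂ} {ρ : ℝ → ℝ}

theorem re_form_pos (hA : numericalRange A ⊆ enclosed γ) (t : ℝ) {u : Fin n → ℂ} (hu : u ≠ 0) :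
    0 < ((starRingEnd ℂ) (unitNormal t) * (star u ⬝ᵥ (γ t • 1 - A).mulVec u)).re := by
  obtain ⟨z, hz, hzu⟩ := exists_mem_numericalRange A hu
  have h1 : (starRingEnd ℂ) (unitNormal t) * (star u ⬝ᵥ (γ t • 1 - A).mulVec u) =
      (sumSq u : ℂ) * ((γ t - z) * (starRingEnd ℂ) (unitNormal t)) := by
    rw [Matrix.sub_mulVec, Matrix.smul_mulVec, Matrix.one_mulVec, dotProduct_sub, dotProduct_smul,
      star_dotProduct_self, hzu, smul_eq_mul]
    ring
  rw [h1, re_ofReal_mul]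
  exact mul_pos (sumSq_pos hu) (hA hz t)

theorem det_sub_ne_zero (hA : numericalRange A ⊆ enclosed γ) (t : ℝ) :
    (γ t • (1 : Matrix (Fin n) (Fin n) ℂ) - A).det ≠ 0 := by
  intro h
  obtain ⟨u, hu, h0⟩ := Matrix.exists_mulVec_eq_zero_iff.2 h
  have := re_form_pos hA t hu
  simp [h0] at this

theorem continuous_resolvent (hγ : Continuous γ) (hA : numericalRange A ⊆ enclosed γ)
    (k l : Fin n) :
    Continuous fun t => (γ t • (1 : Matrix (Fin n) (Fin n) ℂ) - A)⁻¹ k l := by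
  have hc : Continuous fun t => γ t • (1 : Matrix (Fin n) (Fin n) ℂ) - A :=
    (hγ.smul continuous_const).sub continuous_const
  simp only [Matrix.inv_def, Ring.inverse_eq_inv', Matrix.smul_apply, smul_eq_mul]
  exact (hc.matrix_det.inv₀ (det_sub_ne_zero hA)).mul (hc.matrix_adjugate.matrix_elem k l)

/-- The operator-valued density `dσ (σ - A)⁻¹ / (2πi)` of the Cauchy integral. -/
noncomputable def resolventDensity (A : Matrix (Fin n) (Fin n) ℂ) (γ : ℝ → ℂ) (ρ : ℝ → ℝ) (t : ℝ) :
    Matrix (Fin n) (Fin n) ℂ :=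
  lengthElement ρ t • (γ t • (1 : Matrix (Fin n) (Fin n) ℂ) - A)⁻¹

theorem continuous_resolventDensity (h : IsSupportCurve γ ρ)
    (hA : numericalRange A ⊆ enclosed γ) (k l : Fin n) :
    Continuous fun t => resolventDensity A γ ρ t k l :=
  h.continuous_lengthElement.mul (continuous_resolvent h.continuous hA k l)

/-- For `x = (γ - A) u`, the form of the density at `x` is `ρ / 2π` times the conjugate of the form
in `re_form_pos` at `u`; its real part is nonnegative because `W(A)` lies on the inner side of the
tangent. -/
theorem posSemidef_resolventDensity (h : IsSupportCurve γ ρ)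
    (hA : numericalRange A ⊆ enclosed γ) (t : ℝ) :
    (resolventDensity A γ ρ t + (resolventDensity A γ ρ t)ᴴ).PosSemidef := by
  set R := resolventDensity A γ ρ t with hR
  refine Matrix.PosSemidef.of_dotProduct_mulVec_nonneg (Matrix.isHermitian_add_transpose_self R)
    fun x => ?_
  have hform : star x ⬝ᵥ (R + Rᴴ).mulVec x = ((2 * (star x ⬝ᵥ R.mulVec x).re : ℝ) : ℂ) := by
    have h1 : star x ⬝ᵥ Rᴴ.mulVec x = (starRingEnd ℂ) (star x ⬝ᵥ R.mulVec x) := by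
      change _ = star _
      rw [← Matrix.star_dotProduct, Matrix.star_mulVec, ← Matrix.dotProduct_mulVec]
    rw [Matrix.add_mulVec, dotProduct_add, h1, add_conj]
  rw [hform]
  suffices 0 ≤ (star x ⬝ᵥ R.mulVec x).re by
    exact_mod_cast mul_nonneg zero_le_two this
  set N := γ t • (1 : Matrix (Fin n) (Fin n) ℂ) - A with hN
  set u := N⁻¹.mulVec x with hu
  have hx : x = N.mulVec u := by
    rw [hu, Matrix.mulVec_mulVec, Matrix.mul_nonsing_inv _ (Ne.isUnit (det_sub_ne_zero hA t)),
      Matrix.one_mulVec]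
  have hRx : R.mulVec x = lengthElement ρ t • u := by
    rw [hR, resolventDensity, Matrix.smul_mulVec]
  have h2 : star x ⬝ᵥ R.mulVec x =
      ((ρ t / (2 * Real.pi) : ℝ) : ℂ) * (starRingEnd ℂ)
        ((starRingEnd ℂ) (unitNormal t) * (star u ⬝ᵥ N.mulVec u)) := by
    have h3 : star x ⬝ᵥ u = (starRingEnd ℂ) (star u ⬝ᵥ N.mulVec u) := by
      conv_lhs => rw [hx]
      change _ = star _
      rw [← Matrix.star_dotProduct]
    rw [hRx, dotProduct_smul, h3, map_mul, conj_conj, lengthElement, smul_eq_mul]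
    push_cast
    ring
  rw [h2, re_ofReal_mul, conj_re]
  refine mul_nonneg (div_nonneg (h.radius_pos t).le Real.two_pi_pos.le) ?_
  rcases eq_or_ne u 0 with h0 | h0
  · simp [h0]
  · exact (re_form_pos hA t h0).le

theorem isRoot_mem_enclosed (hA : numericalRange A ⊆ enclosed γ) (z : ℂ)
    (hz : (minpoly ℂ A).IsRoot z) : z ∈ enclosed γ :=
  hA (mem_numericalRange_of_isRoot hz)

/-- The matrix function of a Cauchy integral over a convex curve around the numerical range. -/
theorem matrixFunction_eq_integral_resolventDensity (h : IsSupportCurve γ ρ)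
    (hA : numericalRange A ⊆ enclosed γ) {f : ℂ → ℂ} {w : ℝ → ℂ} (hw : Continuous w)
    (hf : ∀ z ∈ enclosed γ, f z = ∫ t in (0 : ℝ)..2 * Real.pi,
      w t * lengthElement ρ t / (γ t - z)) (k l : Fin n) :
    matrixFunction f A k l =
      ∫ t in (0 : ℝ)..2 * Real.pi, w t * resolventDensity A γ ρ t k l := by
  rw [matrixFunction_eq_integral h.isOpen_enclosed h.continuous (hw.mul h.continuous_lengthElement)
    (notMem_enclosed γ) (isRoot_mem_enclosed hA) hf]
  simp only [resolventDensity, Pi.mul_apply, Matrix.smul_apply, smul_eq_mul, mul_assoc]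

theorem integral_resolventDensity (h : IsSupportCurve γ ρ)
    (hA : numericalRange A ⊆ enclosed γ) (k l : Fin n) :
    ∫ t in (0 : ℝ)..2 * Real.pi, resolventDensity A γ ρ t k l =
      (1 : Matrix (Fin n) (Fin n) ℂ) k l := by
  have := matrixFunction_eq_integral_resolventDensity h hA (f := fun _ => 1) (w := fun _ => 1)
    continuous_const (fun z hz => by simpa using (h.integral_logDeriv hz).symm) k l
  simpa [matrixFunction_const] using this.symm

end Resolvent

/-! ### Block matrix functions -/

section Block

variable {m p q n : ℕ} {A : Matrix (Fin n) (Fin n) ℂ}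

theorem blockMatrixFunction_mul {F : ℂ → Matrix (Fin m) (Fin p) ℂ}
    {G : ℂ → Matrix (Fin p) (Fin q) ℂ}
    (hF : ∀ i j z, (minpoly ℂ A).IsRoot z → AnalyticAt ℂ (fun z => F z i j) z)
    (hG : ∀ i j z, (minpoly ℂ A).IsRoot z → AnalyticAt ℂ (fun z => G z i j) z) :
    blockMatrixFunction (fun z => F z * G z) A =
      blockMatrixFunction F A * blockMatrixFunction G A := by
  ext ⟨i, k⟩ ⟨j, l⟩
  simp only [blockMatrixFunction, Matrix.of_apply, Matrix.mul_apply, Fintype.sum_prod_type]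
  rw [matrixFunction_sum _ fun a _ z hz => (hF i a z hz).fun_mul (hG a j z hz), Matrix.sum_apply]
  refine Finset.sum_congr rfl fun a _ => ?_
  rw [matrixFunction_mul (hF i a) (hG a j), Matrix.mul_apply]

theorem blockMatrixFunction_smul (c : ℂ) {F : ℂ → Matrix (Fin m) (Fin p) ℂ}
    (hF : ∀ i j z, (minpoly ℂ A).IsRoot z → AnalyticAt ℂ (fun z => F z i j) z) :
    blockMatrixFunction (fun z => c • F z) A = c • blockMatrixFunction F A := by
  ext ⟨i, k⟩ ⟨j, l⟩
  simp only [blockMatrixFunction, Matrix.of_apply, Matrix.smul_apply, smul_eq_mul]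
  rw [matrixFunction_mul (fun _ _ => analyticAt_const) (hF i j), matrixFunction_const,
    smul_one_mul, Matrix.smul_apply, smul_eq_mul]

end Block

/-! ### The Crouzeix–Palencia estimate -/

theorem intervalIntegral_sum_of_continuous {ι E : Type*} [NormedAddCommGroup E] [NormedSpace ℝ E]
    (s : Finset ι) (a b : ℝ) {f : ι → ℝ → E} (hf : ∀ i, Continuous (f i)) :
    ∫ t in a..b, ∑ i ∈ s, f i t = ∑ i ∈ s, ∫ t in a..b, f i t :=
  intervalIntegral.integral_finsetSum fun i _ => (hf i).intervalIntegrable a b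

section Estimate

open Complex

variable {m p n : ℕ} {A : Matrix (Fin n) (Fin n) ℂ} {γ : ℝ → ℂ} {ρ : ℝ → ℝ} {U : Set ℂ}
  {F : ℂ → Matrix (Fin m) (Fin p) ℂ} {M : ℝ}

/-- The Cauchy transform of `Fᴴ` along the curve. -/
noncomputable def cauchyTransformStar (γ : ℝ → ℂ) (ρ : ℝ → ℝ) (F : ℂ → Matrix (Fin m) (Fin p) ℂ)
    (z : ℂ) : Matrix (Fin p) (Fin m) ℂ :=
  Matrix.of fun j i => ∫ t in (0 : ℝ)..2 * Real.pi,
    (starRingEnd ℂ) (F (γ t) i j) * lengthElement ρ t / (γ t - z)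

theorem differentiableOn_cauchyTransformStar (h : IsSupportCurve γ ρ)
    (hF : ∀ i j, Continuous fun t => F (γ t) i j) (j : Fin p) (i : Fin m) :
    DifferentiableOn ℂ (fun z => cauchyTransformStar γ ρ F z j i) (enclosed γ) :=
  differentiableOn_cauchyTransform h.isOpen_enclosed h.continuous
    ((continuous_conj.comp (hF i j)).mul h.continuous_lengthElement) fun t _ => notMem_enclosed γ t

/-- Each sesquilinear form of the transform is the Cauchy transform of the conjugate of a scalar
holomorphic function, to which the scalar bound applies. -/
theorem norm_cauchyTransformStar_le (h : IsSupportCurve γ ρ) (hU : IsOpen U) (hUc : Convex ℝ U)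
    (hγU : ∀ t, γ t ∈ U) (hF : ∀ i j, DifferentiableOn ℂ (fun z => F z i j) U)
    (hM0 : 0 ≤ M) (hM : ∀ z ∈ U, ‖F z‖ ≤ M) {z : ℂ} (hz : z ∈ enclosed γ) :
    ‖cauchyTransformStar γ ρ F z‖ ≤ M := by
  have hsub := enclosed_subset hU hUc hγU
  have hFc : ∀ i j, Continuous fun t => F (γ t) i j := fun i j =>
    (hF i j).continuousOn.comp_continuous h.continuous hγU
  refine l2_opNorm_le_of_forall hM0 fun x y => ?_
  set f : ℂ → ℂ := fun w => star x ⬝ᵥ (F w).mulVec y with hf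
  have hfd : DifferentiableOn ℂ f U := by
    simp only [hf, dotProduct, Matrix.mulVec]
    exact DifferentiableOn.fun_sum fun i _ => (DifferentiableOn.fun_sum fun j _ =>
      (hF i j).mul_const _).const_mul _
  have hfM : ∀ w ∈ U, ‖f w‖ ≤ M * ((sumSq x + sumSq y) / 2) := fun w hw => by
    refine (norm_star_dotProduct_mulVec_le (F w) y x).trans ?_
    rw [add_comm (sumSq y)]
    have := sumSq_nonneg x
    have := sumSq_nonneg y
    exact mul_le_mul_of_nonneg_right (hM w hw) (by positivity)
  have hc : ∀ i j, Continuous fun t =>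
      (starRingEnd ℂ) (F (γ t) i j) * lengthElement ρ t / (γ t - z) := fun i j =>
    ((continuous_conj.comp (hFc i j)).mul h.continuous_lengthElement).div
      (h.continuous.sub continuous_const) (sub_ne_zero_of_mem_enclosed hz)
  have key : star y ⬝ᵥ (cauchyTransformStar γ ρ F z).mulVec x =
      ∫ t in (0 : ℝ)..2 * Real.pi, (starRingEnd ℂ) (f (γ t)) * lengthElement ρ t / (γ t - z) := by
    have h1 : ∀ t, (starRingEnd ℂ) (f (γ t)) * lengthElement ρ t / (γ t - z) =
        ∑ j, ∑ i, star (y j) * x i *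
          ((starRingEnd ℂ) (F (γ t) i j) * lengthElement ρ t / (γ t - z)) := by
      intro t
      simp only [hf, dotProduct, Matrix.mulVec, map_sum, map_mul, Finset.mul_sum, Finset.sum_mul,
        Finset.sum_div, Pi.star_apply, RCLike.star_def, conj_conj]
      rw [Finset.sum_comm]
      exact Finset.sum_congr rfl fun j _ => Finset.sum_congr rfl fun i _ => by ring
    simp only [h1]
    rw [intervalIntegral_sum_of_continuous]
    swap
    · exact fun j => continuous_finsetSum _ fun i _ => continuous_const.mul (hc i j)
    simp only [dotProduct, Matrix.mulVec, Finset.mul_sum]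
    refine Finset.sum_congr rfl fun j _ => ?_
    rw [intervalIntegral_sum_of_continuous]
    swap
    · exact fun i => continuous_const.mul (hc i j)
    refine Finset.sum_congr rfl fun i _ => ?_
    rw [intervalIntegral.integral_const_mul]
    simp only [cauchyTransformStar, Matrix.of_apply, Pi.star_apply]
    ring
  rw [key]
  exact h.norm_cauchyTransform_conj_le hU hUc hγU hsub hfd hfM hz

/-- The operator-valued double layer potential of `F` has norm at most `2 sup ‖F‖`. -/
theorem norm_block_add_conjTranspose_le (h : IsSupportCurve γ ρ) (hU : IsOpen U)
    (hUc : Convex ℝ U) (hγU : ∀ t, γ t ∈ U) (hA : numericalRange A ⊆ enclosed γ)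
    (hF : ∀ i j, DifferentiableOn ℂ (fun z => F z i j) U)
    (hM0 : 0 ≤ M) (hM : ∀ z ∈ U, ‖F z‖ ≤ M) :
    ‖blockMatrixFunction F A + (blockMatrixFunction (cauchyTransformStar γ ρ F) A)ᴴ‖ ≤ 2 * M := by
  have hsub := enclosed_subset hU hUc hγU
  have hFc : ∀ i j, Continuous fun t => F (γ t) i j := fun i j =>
    (hF i j).continuousOn.comp_continuous h.continuous hγU
  set R := resolventDensity A γ ρ with hR
  have hRc : ∀ k l, Continuous fun t => R t k l := continuous_resolventDensity h hA
  set Q : ℝ → Matrix (Fin n) (Fin n) ℂ := fun t => R t + (R t)ᴴ with hQ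
  have hQc : ∀ k l, Continuous fun t => Q t k l := fun k l =>
    (hRc k l).add (continuous_conj.comp (hRc l k))
  have hQint : ∀ k l, ∫ t in (0 : ℝ)..2 * Real.pi, Q t k l =
      2 * (1 : Matrix (Fin n) (Fin n) ℂ) k l := by
    intro k l
    have h1 : ∀ t, Q t k l = R t k l + (starRingEnd ℂ) (R t l k) := fun t => rfl
    have hRc' : Continuous fun t => (starRingEnd ℂ) (R t l k) := continuous_conj.comp (hRc l k)
    simp only [h1]
    rw [intervalIntegral.integral_add ((hRc k l).intervalIntegrable _ _)
      (hRc'.intervalIntegrable _ _),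
      intervalIntegral.intervalIntegral_conj, integral_resolventDensity h hA,
      integral_resolventDensity h hA]
    rcases eq_or_ne k l with rfl | hkl
    · simp; norm_num
    · simp [Matrix.one_apply_ne hkl, Matrix.one_apply_ne hkl.symm]
  set S := blockMatrixFunction F A + (blockMatrixFunction (cauchyTransformStar γ ρ F) A)ᴴ with hS
  -- Cauchy's formula gives the `R` part; the adjoint undoes the conjugation of `F` and gives the
  -- `Rᴴ` part.
  have hSentry : ∀ i k j l, S (i, k) (j, l) =
      ∫ t in (0 : ℝ)..2 * Real.pi, F (γ t) i j * Q t k l := by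
    intro i k j l
    have h1 := matrixFunction_eq_integral_resolventDensity h hA (hFc i j)
      (fun z hz => h.cauchy_formula hU hUc hγU (hF i j) hz (hsub hz)) k l
    have h2 := matrixFunction_eq_integral_resolventDensity h hA (continuous_conj.comp (hFc i j))
      (f := fun z => cauchyTransformStar γ ρ F z j i) (fun z hz => rfl) l k
    have h3 : S (i, k) (j, l) = matrixFunction (fun z => F z i j) A k l +
      (starRingEnd ℂ) (matrixFunction (fun z => cauchyTransformStar γ ρ F z j i) A l k) := rfl
    rw [h3, h1, h2, ← intervalIntegral.intervalIntegral_conj, ← intervalIntegral.integral_add]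
    · refine intervalIntegral.integral_congr fun t _ => ?_
      have h4 : Q t k l = R t k l + (starRingEnd ℂ) (R t l k) := rfl
      simp only [h4, Function.comp_apply, map_mul, conj_conj]
      ring
    · exact ((hFc i j).mul (hRc k l)).intervalIntegrable _ _
    · exact (continuous_conj.comp
        ((continuous_conj.comp (hFc i j)).mul (hRc l k))).intervalIntegrable _ _
  refine l2_opNorm_le_of_forall (by positivity) fun x y => ?_
  have hform : ∀ {d : ℕ} (u : Fin d × Fin n → ℂ), Continuous fun t =>
      (∑ j, (star (fun k => u (j, k)) ⬝ᵥ (Q t).mulVec fun l => u (j, l)).re) := by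
    intro d u
    simp only [dotProduct, Matrix.mulVec]
    exact continuous_finsetSum _ fun j _ => continuous_re.comp <| continuous_finsetSum _ fun k _ =>
      continuous_const.mul <| continuous_finsetSum _ fun l _ => (hQc k l).mul continuous_const
  have hformint : ∀ {d : ℕ} (u : Fin d × Fin n → ℂ), ∫ t in (0 : ℝ)..2 * Real.pi,
      (∑ j, (star (fun k => u (j, k)) ⬝ᵥ (Q t).mulVec fun l => u (j, l)).re) = 2 * sumSq u := by
    intro d u
    have h1 : ∀ j, Continuous fun t =>
        star (fun k => u (j, k)) ⬝ᵥ (Q t).mulVec fun l => u (j, l) := by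
      intro j
      simp only [dotProduct, Matrix.mulVec]
      exact continuous_finsetSum _ fun k _ =>
        continuous_const.mul <| continuous_finsetSum _ fun l _ => (hQc k l).mul continuous_const
    have h2 : ∀ j, ∫ t in (0 : ℝ)..2 * Real.pi,
        (star (fun k => u (j, k)) ⬝ᵥ (Q t).mulVec fun l => u (j, l)) =
        2 * (sumSq fun k => u (j, k) : ℂ) := by
      intro j
      rw [← star_dotProduct_self]
      simp only [dotProduct, Matrix.mulVec]
      rw [intervalIntegral_sum_of_continuous]
      swap
      · exact fun k => continuous_const.mul <|
          continuous_finsetSum _ fun l _ => (hQc k l).mul continuous_const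
      rw [Finset.mul_sum]
      refine Finset.sum_congr rfl fun k _ => ?_
      rw [intervalIntegral.integral_const_mul, intervalIntegral_sum_of_continuous]
      swap
      · exact fun l => (hQc k l).mul continuous_const
      simp only [intervalIntegral.integral_mul_const, hQint]
      rw [Finset.sum_eq_single k (fun l _ hl => by simp [Matrix.one_apply_ne hl.symm]) (by simp)]
      simp only [Matrix.one_apply_eq]
      ring
    rw [intervalIntegral_sum_of_continuous]
    swap
    · exact fun j => continuous_re.comp (h1 j)
    have h3 : ∀ j, ∫ t in (0 : ℝ)..2 * Real.pi,
        (star (fun k => u (j, k)) ⬝ᵥ (Q t).mulVec fun l => u (j, l)).re =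
        2 * sumSq fun k => u (j, k) := by
      intro j
      have := reCLM.intervalIntegral_comp_comm ((h1 j).intervalIntegrable
        (μ := MeasureTheory.volume) 0 (2 * Real.pi))
      simp only [reCLM_apply, h2] at this
      rw [this]
      simp
    simp only [h3, ← Finset.mul_sum]
    simp only [sumSq, Fintype.sum_prod_type]
  have hSint : star y ⬝ᵥ S.mulVec x = ∫ t in (0 : ℝ)..2 * Real.pi,
      ∑ i, ∑ j, F (γ t) i j * (star (fun k => y (i, k)) ⬝ᵥ (Q t).mulVec fun l => x (j, l)) := by
    have hc : ∀ i j, Continuous fun t =>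
        F (γ t) i j * (star (fun k => y (i, k)) ⬝ᵥ (Q t).mulVec fun l => x (j, l)) := by
      intro i j
      simp only [dotProduct, Matrix.mulVec]
      exact (hFc i j).mul <| continuous_finsetSum _ fun k _ =>
        continuous_const.mul <| continuous_finsetSum _ fun l _ => (hQc k l).mul continuous_const
    have hc' : ∀ i j k l, Continuous fun t =>
        F (γ t) i j * ((star fun k => y (i, k)) k * (Q t k l * x (j, l))) := fun i j k l =>
      (hFc i j).mul (continuous_const.mul ((hQc k l).mul continuous_const))
    rw [intervalIntegral_sum_of_continuous]
    swap
    · exact fun i => continuous_finsetSum _ fun j _ => hc i j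
    simp only [dotProduct, Matrix.mulVec, Fintype.sum_prod_type, Finset.mul_sum]
    refine Finset.sum_congr rfl fun i _ => ?_
    rw [intervalIntegral_sum_of_continuous]
    swap
    · exact fun j => continuous_finsetSum _ fun k _ => continuous_finsetSum _ fun l _ =>
        hc' i j k l
    rw [Finset.sum_comm]
    refine Finset.sum_congr rfl fun j _ => ?_
    rw [intervalIntegral_sum_of_continuous]
    swap
    · exact fun k => continuous_finsetSum _ fun l _ => hc' i j k l
    refine Finset.sum_congr rfl fun k _ => ?_
    rw [intervalIntegral_sum_of_continuous]
    swap
    · exact fun l => hc' i j k l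
    refine Finset.sum_congr rfl fun l _ => ?_
    rw [hSentry, ← intervalIntegral.integral_mul_const, ← intervalIntegral.integral_const_mul]
    refine intervalIntegral.integral_congr fun t _ => ?_
    simp only [Pi.star_apply]
    ring
  have hnn : ∀ {d : ℕ} (u : Fin d × Fin n → ℂ) (t : ℝ),
      0 ≤ ∑ j, (star (fun k => u (j, k)) ⬝ᵥ (Q t).mulVec fun l => u (j, l)).re := fun u t =>
    Finset.sum_nonneg fun j _ =>
      (Complex.le_def.1 ((posSemidef_resolventDensity h hA t).dotProduct_mulVec_nonneg _)).1
  rw [hSint]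
  -- The Schur-type bound is applied pointwise; the forms of `Q` then integrate to twice the squared
  -- norms, whence the constant 2.
  have hbound := intervalIntegral.norm_integral_le_of_norm_le (μ := MeasureTheory.volume)
    (f := fun t => ∑ i, ∑ j, F (γ t) i j *
      (star (fun k => y (i, k)) ⬝ᵥ (Q t).mulVec fun l => x (j, l)))
    (g := fun t => M * (((∑ j, (star (fun k => x (j, k)) ⬝ᵥ (Q t).mulVec fun l => x (j, l)).re) +
        ∑ i, (star (fun k => y (i, k)) ⬝ᵥ (Q t).mulVec fun l => y (i, l)).re) / 2))
    Real.two_pi_pos.le (Filter.Eventually.of_forall fun t _ =>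
      (norm_kronecker_form_le (F (γ t)) (posSemidef_resolventDensity h hA t) x y).trans
        (mul_le_mul_of_nonneg_right (hM _ (hγU t))
          (div_nonneg (add_nonneg (hnn x t) (hnn y t)) zero_le_two)))
    ((continuous_const.mul (((hform x).add (hform y)).div_const 2)).intervalIntegrable _ _)
  refine hbound.trans (le_of_eq ?_)
  rw [intervalIntegral.integral_const_mul, intervalIntegral.integral_div,
    intervalIntegral.integral_add ((hform x).intervalIntegrable _ _)
      ((hform y).intervalIntegrable _ _), hformint, hformint]
  ring

/-- A priori bound for matrix functions, uniform in the domain of holomorphy. -/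
theorem exists_norm_blockMatrixFunction_le (h : IsSupportCurve γ ρ)
    (hA : numericalRange A ⊆ enclosed γ) (m p : ℕ) :
    ∃ C : ℝ, ∀ (U : Set ℂ) (F : ℂ → Matrix (Fin m) (Fin p) ℂ), IsOpen U → Convex ℝ U →
      (∀ t, γ t ∈ U) → (∀ i j, DifferentiableOn ℂ (fun z => F z i j) U) →
      (∀ z ∈ U, ‖F z‖ ≤ 1) → ‖blockMatrixFunction F A‖ ≤ C := by
  have hRc : ∀ k l, Continuous fun t => resolventDensity A γ ρ t k l :=
    continuous_resolventDensity h hA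
  have hI0 : ∀ k l, 0 ≤ ∫ t in (0 : ℝ)..2 * Real.pi, ‖resolventDensity A γ ρ t k l‖ := fun k l =>
    intervalIntegral.integral_nonneg Real.two_pi_pos.le fun t _ => norm_nonneg _
  refine ⟨_, fun U F hU hUc hγU hF hM => l2_opNorm_le_of_norm_entry_le
    (B := ∑ k, ∑ l, ∫ t in (0 : ℝ)..2 * Real.pi, ‖resolventDensity A γ ρ t k l‖)
    (Finset.sum_nonneg fun k _ => Finset.sum_nonneg fun l _ => hI0 k l) ?_⟩
  rintro ⟨i, k⟩ ⟨j, l⟩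
  have hFc : Continuous fun t => F (γ t) i j :=
    (hF i j).continuousOn.comp_continuous h.continuous hγU
  change ‖matrixFunction (fun z => F z i j) A k l‖ ≤ _
  -- Cauchy's formula on the given curve leaves a bound by the resolvent density alone, independent
  -- of `U` and `F`.
  rw [matrixFunction_eq_integral_resolventDensity h hA hFc
      (fun z hz => h.cauchy_formula hU hUc hγU (hF i j) hz (enclosed_subset hU hUc hγU hz)) k l]
  calc _ ≤ ∫ t in (0 : ℝ)..2 * Real.pi, ‖resolventDensity A γ ρ t k l‖ := by
        refine intervalIntegral.norm_integral_le_of_norm_le Real.two_pi_pos.le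
          (Filter.Eventually.of_forall fun t _ => ?_) ((hRc k l).norm.intervalIntegrable _ _)
        rw [norm_mul]
        exact mul_le_of_le_one_left (norm_nonneg _)
          ((norm_entry_le_l2_opNorm _ i j).trans (hM _ (hγU t)))
    _ ≤ ∑ l, ∫ t in (0 : ℝ)..2 * Real.pi, ‖resolventDensity A γ ρ t k l‖ :=
        Finset.single_le_sum (f := fun l =>
          ∫ t in (0 : ℝ)..2 * Real.pi, ‖resolventDensity A γ ρ t k l‖) (fun l _ => hI0 k l)
          (Finset.mem_univ l)
    _ ≤ _ := Finset.single_le_sum (f := fun k => ∑ l,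
          ∫ t in (0 : ℝ)..2 * Real.pi, ‖resolventDensity A γ ρ t k l‖)
          (fun k _ => Finset.sum_nonneg fun l _ => hI0 k l) (Finset.mem_univ k)

end Estimate

/-! ### The extremal argument -/

theorem l2_opNorm_four_le {ι κ : Type*} [Fintype ι] [Fintype κ] [DecidableEq ι] [DecidableEq κ]
    (X : Matrix ι κ ℂ) (Y : Matrix κ ι ℂ) {L : ℝ} (hS : ‖X + Yᴴ‖ ≤ 2) (hL : ‖X * Y * X‖ ≤ L) :
    ‖X‖ ^ 4 ≤ 2 * ‖X‖ ^ 3 + L * ‖X‖ := by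
  have h1 : ‖X * Xᴴ‖ = ‖X‖ ^ 2 := by
    have := Matrix.l2_opNorm_conjTranspose_mul_self Xᴴ
    rwa [Matrix.conjTranspose_conjTranspose, Matrix.l2_opNorm_conjTranspose, ← sq] at this
  have h2 : ‖X * Xᴴ * (X * Xᴴ)‖ = ‖X‖ ^ 4 := by
    have := Matrix.l2_opNorm_conjTranspose_mul_self (X * Xᴴ)
    rw [Matrix.conjTranspose_mul, Matrix.conjTranspose_conjTranspose, h1] at this
    rw [this]; ring
  have h3 : X * Xᴴ * (X * Xᴴ) = X * (X + Yᴴ)ᴴ * (X * Xᴴ) - X * Y * X * Xᴴ := by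
    rw [Matrix.conjTranspose_add, Matrix.conjTranspose_conjTranspose, Matrix.mul_add,
      Matrix.add_mul]
    simp only [Matrix.mul_assoc, add_sub_cancel_right]
  have hX := norm_nonneg X
  calc ‖X‖ ^ 4 = ‖X * (X + Yᴴ)ᴴ * (X * Xᴴ) - X * Y * X * Xᴴ‖ := by rw [← h2, h3]
    _ ≤ ‖X * (X + Yᴴ)ᴴ * (X * Xᴴ)‖ + ‖X * Y * X * Xᴴ‖ := norm_sub_le _ _
    _ ≤ ‖X‖ * ‖(X + Yᴴ)ᴴ‖ * ‖X * Xᴴ‖ + ‖X * Y * X‖ * ‖Xᴴ‖ :=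
        add_le_add ((Matrix.l2_opNorm_mul _ _).trans
          (mul_le_mul_of_nonneg_right (Matrix.l2_opNorm_mul _ _) (norm_nonneg _)))
          (Matrix.l2_opNorm_mul _ _)
    _ ≤ ‖X‖ * 2 * ‖X‖ ^ 2 + L * ‖X‖ := by
        rw [h1, Matrix.l2_opNorm_conjTranspose, Matrix.l2_opNorm_conjTranspose]
        gcongr
    _ = _ := by ring

/-- If `L = sSup s` exceeded `1 + √2`, then `L² - 2L - 1 > 0` and the quartic inequality would fail
at `L`. By continuity it would fail at elements of `s` close to `L`, so the supremum need not be
attained. -/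
theorem le_one_add_sqrt_two_of_sSup {s : Set ℝ} (hbdd : BddAbove s)
    (h : ∀ r ∈ s, r ^ 4 ≤ 2 * r ^ 3 + sSup s * r) {r : ℝ} (hr : r ∈ s) :
    r ≤ 1 + Real.sqrt 2 := by
  have h2 : Real.sqrt 2 ^ 2 = 2 := Real.sq_sqrt zero_le_two
  have hs0 := Real.sqrt_nonneg 2
  refine (le_csSup hbdd hr).trans ?_
  by_contra! hcon
  set L := sSup s with hL
  have hpos : 2 * L ^ 3 + L * L < L ^ 4 := by
    have hL0 : 0 < L := by linarith
    have h3 : 0 < L ^ 2 - 2 * L - 1 := by nlinarith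
    have h4 : 0 < L ^ 2 := by positivity
    nlinarith [mul_pos h4 h3]
  have hc : ContinuousAt (fun r : ℝ => r ^ 4 - 2 * r ^ 3 - L * r) L := by fun_prop
  obtain ⟨ε, hε, hball⟩ := Metric.eventually_nhds_iff.1
    (hc.eventually (lt_mem_nhds (show (0 : ℝ) < L ^ 4 - 2 * L ^ 3 - L * L by linarith)))
  obtain ⟨r', hr's, hr'⟩ := exists_lt_of_lt_csSup ⟨r, hr⟩ (show L - ε < sSup s by linarith)
  have hle := le_csSup hbdd hr's
  have := hball (y := r') (by rw [Real.dist_eq, abs_lt]; constructor <;> linarith)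
  linarith [h r' hr's]

/-- Finitely many small polytopes in `U` cover `s`, and the convex hull of all their vertices is
compact and stays in `U`. Convexity of `s` plays no role. -/
theorem exists_isCompact_convex_between {E : Type*} [NormedAddCommGroup E] [NormedSpace ℝ E]
    [FiniteDimensional ℝ E] {s U : Set E} (hs : IsCompact s) (hU : IsOpen U) (hUc : Convex ℝ U)
    (hsU : s ⊆ U) : ∃ K, IsCompact K ∧ Convex ℝ K ∧ s ⊆ K ∧ K ⊆ U := by
  have hloc : ∀ x ∈ s, ∃ v : Set E, v.Finite ∧ x ∈ interior (convexHull ℝ v) ∧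
      convexHull ℝ v ⊆ U := fun x hx => by
    obtain ⟨b, hxb, hbU⟩ := exists_mem_interior_convexHull_affineBasis (hU.mem_nhds (hsU hx))
    exact ⟨Set.range b, Set.finite_range _, hxb, hbU⟩
  choose! v hvf hxv hvU using hloc
  obtain ⟨t, hts, hst⟩ := hs.elim_nhds_subcover (fun x => interior (convexHull ℝ (v x)))
    fun x hx => isOpen_interior.mem_nhds (hxv x hx)
  have hfin : (⋃ x ∈ t, v x).Finite := t.finite_toSet.biUnion fun x hx => hvf x (hts x hx)
  refine ⟨convexHull ℝ (⋃ x ∈ t, v x), hfin.isCompact_convexHull ℝ,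
    convex_convexHull ℝ _, hst.trans ?_, convexHull_min ?_ hUc⟩
  · exact Set.iUnion₂_subset fun x hx => interior_subset.trans
      (convexHull_mono (Set.subset_biUnion_of_mem (u := v) hx))
  · exact Set.iUnion₂_subset fun x hx => (subset_convexHull ℝ _).trans (hvU x (hts x hx))

/-- The Crouzeix–Palencia theorem for a convex open set and matrix-valued functions of norm at
most one. -/
theorem norm_blockMatrixFunction_le_of_norm_le_one {m p n : ℕ} {A : Matrix (Fin n) (Fin n) ℂ}
    {Ω : Set ℂ} (hΩ : IsOpen Ω) (hΩc : Convex ℝ Ω) (hΩne : Ω.Nonempty)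
    (hA : numericalRange A ⊆ Ω) {F : ℂ → Matrix (Fin m) (Fin p) ℂ}
    (hF : ∀ i j, DifferentiableOn ℂ (fun z => F z i j) Ω) (hM : ∀ z ∈ Ω, ‖F z‖ ≤ 1) :
    ‖blockMatrixFunction F A‖ ≤ 1 + Real.sqrt 2 := by
  obtain ⟨w₀, hw₀⟩ := hΩne
  -- The point `w₀` keeps the compact set nonempty when `n = 0` and the numerical range is empty.
  obtain ⟨K₁, hK₁c, hK₁conv, hsK₁, hK₁Ω⟩ := exists_isCompact_convex_between
    ((isCompact_numericalRange A).insert w₀) hΩ hΩc (Set.insert_subset hw₀ hA)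
  obtain ⟨γ₀, ρ₀, h₀, hγ₀Ω, hK₁γ₀⟩ :=
    exists_isSupportCurve hK₁c hK₁conv ⟨w₀, hsK₁ (Set.mem_insert _ _)⟩ hΩ hK₁Ω
  have hrange : IsCompact (Set.range γ₀) := by
    have := h₀.periodic.image_Icc Real.two_pi_pos 0
    rw [zero_add] at this
    rw [← this]
    exact isCompact_Icc.image h₀.continuous
  -- `K` includes the curve `γ₀`, so every competing domain contains it and the a priori bound is
  -- uniform.
  obtain ⟨K, hKc, hKconv, hsK, hKΩ⟩ := exists_isCompact_convex_between (hrange.union hK₁c) hΩ hΩc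
    (Set.union_subset (Set.range_subset_iff.2 hγ₀Ω) hK₁Ω)
  have hAK₁ : numericalRange A ⊆ K₁ := (Set.subset_insert _ _).trans hsK₁
  have hγ₀K : ∀ t, γ₀ t ∈ K := fun t => hsK (Or.inl ⟨t, rfl⟩)
  have hAK : numericalRange A ⊆ K := fun z hz => hsK (Or.inr (hAK₁ hz))
  obtain ⟨C, hC⟩ := exists_norm_blockMatrixFunction_le h₀ (hAK₁.trans hK₁γ₀) m p
  set s : Set ℝ := {r | ∃ (U : Set ℂ) (F : ℂ → Matrix (Fin m) (Fin p) ℂ), IsOpen U ∧ Convex ℝ U ∧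
    K ⊆ U ∧ (∀ i j, DifferentiableOn ℂ (fun z => F z i j) U) ∧ (∀ z ∈ U, ‖F z‖ ≤ 1) ∧
    r = ‖blockMatrixFunction F A‖} with hs
  have hbdd : BddAbove s := by
    refine ⟨C, ?_⟩
    rintro r ⟨U, F, hU, hUc, hKU, hF, hM, rfl⟩
    exact hC U F hU hUc (fun t => hKU (hγ₀K t)) hF hM
  refine le_one_add_sqrt_two_of_sSup hbdd ?_ (⟨Ω, F, hΩ, hΩc, hKΩ, hF, hM, rfl⟩ : _ ∈ s)
  rintro r ⟨U, F, hU, hUc, hKU, hF, hM, rfl⟩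
  obtain ⟨γ, ρ, h, hγU, hKγ⟩ := exists_isSupportCurve hKc hKconv ⟨_, hγ₀K 0⟩ hU hKU
  have hsub := enclosed_subset hU hUc hγU
  set G := cauchyTransformStar γ ρ F with hG
  have hFe : ∀ i j, DifferentiableOn ℂ (fun z => F z i j) (enclosed γ) := fun i j =>
    (hF i j).mono hsub
  have hGe : ∀ j i, DifferentiableOn ℂ (fun z => G z j i) (enclosed γ) :=
    differentiableOn_cauchyTransformStar h fun i j =>
      (hF i j).continuousOn.comp_continuous h.continuous hγU
  have hFGe : ∀ i j, DifferentiableOn ℂ (fun z => (F z * G z) i j) (enclosed γ) := fun i j => by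
    simp only [Matrix.mul_apply]
    exact DifferentiableOn.fun_sum fun a _ => (hFe i a).mul (hGe a j)
  have hFGFe : ∀ i j, DifferentiableOn ℂ (fun z => (F z * G z * F z) i j) (enclosed γ) :=
    fun i j => by
      simp only [Matrix.mul_apply (M := F _ * G _)]
      exact DifferentiableOn.fun_sum fun a _ => (hFGe i a).mul (hFe a j)
  have hAγ := hAK.trans hKγ
  have han : ∀ {f : ℂ → ℂ}, DifferentiableOn ℂ f (enclosed γ) →
      ∀ z, (minpoly ℂ A).IsRoot z → AnalyticAt ℂ f z := fun hf z hz =>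
    hf.analyticAt (h.isOpen_enclosed.mem_nhds (isRoot_mem_enclosed hAγ z hz))
  have hS := norm_block_add_conjTranspose_le h hU hUc hγU hAγ hF zero_le_one hM
  rw [mul_one] at hS
  -- The function `F G F` on the region enclosed by `γ` is a competitor, because that region is
  -- convex, open and still contains `K`.
  refine l2_opNorm_four_le _ _ hS (le_csSup hbdd ⟨enclosed γ, fun z => F z * G z * F z,
    h.isOpen_enclosed, convex_enclosed γ, hKγ, hFGFe, fun z hz => ?_, ?_⟩)
  · have h1 := hM z (hsub hz)
    have h2 := norm_cauchyTransformStar_le h hU hUc hγU hF zero_le_one hM hz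
    refine (Matrix.l2_opNorm_mul _ _).trans ?_
    refine mul_le_one₀ ((Matrix.l2_opNorm_mul _ _).trans ?_) (norm_nonneg _) h1
    exact mul_le_one₀ h1 (norm_nonneg _) h2
  · rw [blockMatrixFunction_mul (fun i j => han (hFGe i j)) (fun i j => han (hFe i j)),
      blockMatrixFunction_mul (fun i j => han (hFe i j)) (fun i j => han (hGe i j))]

end CrouzeixPalencia

theorem theorem2p3 {m p n : ℕ} (Ω : Set ℂ)
    (hΩ : CrouzeixPalencia.IsSmoothBoundedConvexDomain Ω)
    (F : ℂ → Matrix (Fin m) (Fin p) ℂ)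
    (hF : ∀ i j, AnalyticOnNhd ℂ (fun z => F z i j) Ω)
    (hFext : ∃ F' : ℂ → Matrix (Fin m) (Fin p) ℂ,
      ContinuousOn F' (closure Ω) ∧ Set.EqOn F' F Ω)
    (A : Matrix (Fin n) (Fin n) ℂ)
    (hA : CrouzeixPalencia.numericalRange A ⊆ Ω) :
    ‖CrouzeixPalencia.blockMatrixFunction F A‖ ≤
      (1 + Real.sqrt 2) * CrouzeixPalencia.supNorm Ω F := by
  obtain ⟨F', hF'c, hF'⟩ := hFext
  have hbdd : BddAbove (Set.range fun z : Ω => ‖F z‖) := by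
    obtain ⟨C, hC⟩ := hΩ.isBounded.isCompact_closure.exists_bound_of_continuousOn hF'c
    refine ⟨C, ?_⟩
    rintro _ ⟨z, rfl⟩
    simp only [← hF' z.2]
    exact hC z (subset_closure z.2)
  have hle : ∀ z ∈ Ω, ‖F z‖ ≤ CrouzeixPalencia.supNorm Ω F := fun z hz => le_ciSup hbdd ⟨z, hz⟩
  have hM0 : 0 ≤ CrouzeixPalencia.supNorm Ω F := Real.iSup_nonneg fun _ => norm_nonneg _
  have hc : 0 < 1 + Real.sqrt 2 := by positivity
  refine le_of_forall_pos_le_add fun ε hε => ?_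
  -- The added term keeps the normalising constant positive even when `F` vanishes on `Ω`, and
  -- contributes exactly `ε` after multiplication by `1 + √2`.
  set M := CrouzeixPalencia.supNorm Ω F + ε / (1 + Real.sqrt 2) with hM
  have hMpos : 0 < M := by positivity
  have h1 := CrouzeixPalencia.norm_blockMatrixFunction_le_of_norm_le_one (F := fun z => ((M⁻¹ : ℝ) : ℂ) • F z)
    hΩ.isOpen hΩ.convex hΩ.nonempty hA
    (fun i j => (hF i j).differentiableOn.const_mul _) fun z hz => by
      rw [norm_smul, Complex.norm_real, Real.norm_of_nonneg (by positivity), inv_mul_le_one₀ hMpos]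
      exact (hle z hz).trans (by rw [hM]; linarith [div_pos hε hc])
  rw [CrouzeixPalencia.blockMatrixFunction_smul _ fun i j z hz => hF i j z (hA (CrouzeixPalencia.mem_numericalRange_of_isRoot hz)),
    norm_smul, Complex.norm_real, Real.norm_of_nonneg (by positivity), inv_mul_le_iff₀ hMpos] at h1
  refine h1.trans (le_of_eq ?_)
  rw [hM]
  field_simp
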